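/- Let $F$ be an algebraically closed field of characteristic $p\ge 0$, let $q\in F^\times$, and let $e$ be the least positive integer with $1+q+\dots+q^{e-1}=0$; assume that it exists (so $e>1$). For $n\ge 0$ let $\mathcal H_n=\mathcal H_n(F,q)$ be the Hecke algebra of the symmetric group $\mathfrak S_n$, that is, the $F$-algebra with generators $T_1,\dots,T_{n-1}$ and relations $(T_i-q)(T_i+1)=0$, $T_iT_j=T_jT_i$ for $|i-j|>1$, and $T_iT_{i+1}T_i=T_{i+1}T_iT_{i+1}$. For $w\in\mathfrak S_n$ put $T_w=T_{i_1}\cdots T_{i_t}$ for a reduced expression $w=s_{i_1}\cdots s_{i_t}$. For a composition $\lambda$ of $n$ let $\mathfrak S_\lambda\subseteq\mathfrak S_n$ be the corresponding standard parabolic subgroup and $\mathcal H_\lambda=\langle T_w: w\in\mathfrak S_\lambda\rangle$ the parabolic subalgebra. An $(\mathcal H_n,\mathcal H_n)$-bimodule $M$ is relatively $(\mathfrak S_\lambda,\mathfrak S_\lambda)$-projective if, as an $\mathcal H_n\otimes_F\mathcal H_n^{\mathrm{op}}$-module, it is relatively projective with respect to the subalgebra $\mathcal H_\lambda\otimes_F\mathcal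 H_\lambda^{\mathrm{op}}$: whenever $\beta:V\to W$ is a surjective bimodule homomorphism and a bimodule homomorphism $\alpha:M\to W$ lifts along $\beta$ to an $\mathcal H_\lambda\otimes\mathcal H_\lambda^{\mathrm{op}}$-linear map $M\to V$, it also lifts along $\beta$ to a bimodule homomorphism. Let $d\ge 0$, and let $B$ be the block of $\mathcal H_{de}$ with empty $e$-core, that is, the block to which all the Specht modules $S^\mu$ belong for which $\mu$ is a partition of $de$ with empty $e$-core. If $p>0$, write $de=a_0e+a_1ep+\dots+a_tep^t$ with $0\le a_i<p$ and let $\lambda=(e^{a_0},(ep)^{a_1},\dots,(ep^t)^{a_t})$; if $p=0$, let $\lambda=(e^d)$. Thus $\mathfrak S_\lambda$ is the standard maximal $e$-$p$-parabolic subgroup of $\mathfrak S_{de}$. Then: (1) As an $(\mathcal H_{de},\mathcal H_{de})$-bimodule, $B$ is isomorphic to a direct summand of $B\otimes_{\mathcal H_\lambda}B$. (2) As an $(\mathcal H_{de},\mathcal H_{de})$-bimodule, $B$ is relatively $(\mathfrak S_\lambda,\mathfrak S_\lambda)$-projective. (3) If $p=0$, then the whole algebra $\mathcal H_{de}$ is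 relatively $(\mathfrak S_{(e^d)},\mathfrak S_{(e^d)})$-projective as an $(\mathcal H_{de},\mathcal H_{de})$-bimodule. -/

import Mathlib

universe u

open scoped TensorProduct

noncomputable section

/-! ## The Hecke algebra of type `A_{n-1}` -/

/-- The defining relations of the Hecke algebra, on the free algebra with generators
`T_1, …, T_{n-1}` (indexed here by `0, …, n-2`). -/
inductive HeckeRel (F : Type u) [Field F] (q : F) (n : ℕ) :
    FreeAlgebra F (Fin (n - 1)) → FreeAlgebra F (Fin (n - 1)) → Prop
  | quadratic (i : Fin (n - 1)) :
      HeckeRel F q n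
        ((FreeAlgebra.ι F i - algebraMap F _ q) * (FreeAlgebra.ι F i + 1)) 0
  | comm (i j : Fin (n - 1)) (h : i.val + 1 < j.val) :
      HeckeRel F q n
        (FreeAlgebra.ι F i * FreeAlgebra.ι F j) (FreeAlgebra.ι F j * FreeAlgebra.ι F i)
  | braid (i j : Fin (n - 1)) (h : i.val + 1 = j.val) :
      HeckeRel F q n
        (FreeAlgebra.ι F i * FreeAlgebra.ι F j * FreeAlgebra.ι F i)
        (FreeAlgebra.ι F j * FreeAlgebra.ι F i * FreeAlgebra.ι F j)

/-- The Hecke algebra `H_n(F, q)`, by generators and relations. -/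
abbrev HeckeAlgebra (F : Type u) [Field F] (q : F) (n : ℕ) : Type u :=
  RingQuot (HeckeRel F q n)

namespace HeckeAlgebra

variable {F : Type u} [Field F] {q : F} {n : ℕ}

/-- The generator `T_i`. -/
def gen (q : F) (i : Fin (n - 1)) : HeckeAlgebra F q n :=
  RingQuot.mkAlgHom F (HeckeRel F q n) (FreeAlgebra.ι F i)

/-- The elementary transposition `s_i` of the symmetric group. -/
def simpleTransposition (i : Fin (n - 1)) : Equiv.Perm (Fin n) :=
  Equiv.swap ⟨i.val, by omega⟩ ⟨i.val + 1, by omega⟩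

/-- `l = [i_1, …, i_t]` is a reduced expression `w = s_{i_1} ⋯ s_{i_t}`: no shorter word in the
elementary transpositions has product `w`. -/
def IsReducedWord (w : Equiv.Perm (Fin n)) (l : List (Fin (n - 1))) : Prop :=
  (l.map simpleTransposition).prod = w ∧
    ∀ l' : List (Fin (n - 1)), (l'.map simpleTransposition).prod = w → l.length ≤ l'.length

theorem exists_word (w : Equiv.Perm (Fin n)) :
    ∃ l : List (Fin (n - 1)), (l.map simpleTransposition).prod = w := by
  rcases n with _ | m
  · exact ⟨[], Subsingleton.elim _ _⟩
  · have hw : w ∈ Submonoid.closure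
        (Set.range fun i : Fin m => Equiv.swap i.castSucc i.succ) := by
      rw [Equiv.Perm.mclosure_swap_castSucc_succ]; trivial
    induction hw using Submonoid.closure_induction with
    | mem x hx =>
      obtain ⟨i, rfl⟩ := hx
      exact ⟨[i], by simp [simpleTransposition]; rfl⟩
    | one => exact ⟨[], rfl⟩
    | mul x y _ _ hx hy =>
      obtain ⟨l, rfl⟩ := hx
      obtain ⟨l', rfl⟩ := hy
      exact ⟨l ++ l', by simp⟩

theorem exists_reducedWord (w : Equiv.Perm (Fin n)) :
    ∃ l : List (Fin (n - 1)), IsReducedWord w l := by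
  classical
  have h : ∃ k, ∃ l : List (Fin (n - 1)),
      l.length = k ∧ (l.map simpleTransposition).prod = w :=
    let ⟨l, hl⟩ := exists_word w
    ⟨_, l, rfl, hl⟩
  obtain ⟨l, hk, hl⟩ := Nat.find_spec h
  exact ⟨l, hl, fun l' hl' => hk ▸ Nat.find_min' h ⟨l', rfl, hl'⟩⟩

/-- The basis element `T_w = T_{i_1} ⋯ T_{i_t}`, for a reduced expression of `w` (by the braid
relations the choice of the reduced expression is immaterial). -/
def T (q : F) (w : Equiv.Perm (Fin n)) : HeckeAlgebra F q n :=
  ((exists_reducedWord w).choose.map (gen q)).prod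

end HeckeAlgebra

/-- The quantum characteristic of `q`: the least `e > 0` with `1 + q + ⋯ + q^{e-1} = 0`, and `0` if
there is none. -/
def quantumChar {F : Type u} [Field F] (q : F) : ℕ :=
  sInf {k : ℕ | 0 < k ∧ ∑ i ∈ Finset.range k, q ^ i = 0}

/-! ## Parabolic subgroups and subalgebras -/

/-- The parabolic subgroup `S_c` attached to a composition `c` of `n`: the permutations that
preserve each of the consecutive blocks of `c`. -/
def parabolicSubgroup {n : ℕ} (c : Composition n) : Subgroup (Equiv.Perm (Fin n)) where
  carrier := {w | ∀ i, c.index (w i) = c.index i}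
  mul_mem' := fun {v w} hv hw i => (hv (w i)).trans (hw i)
  one_mem' := fun _ => rfl
  inv_mem' := fun {w} hw i => by simpa using (hw (w⁻¹ i)).symm

/-- The parabolic subalgebra `H_c = ⟨T_w : w ∈ S_c⟩`. -/
def parabolicSubalgebra {F : Type u} [Field F] (q : F) {n : ℕ} (c : Composition n) :
    Subalgebra F (HeckeAlgebra F q n) :=
  Algebra.adjoin F {x | ∃ w ∈ parabolicSubgroup c, x = HeckeAlgebra.T q w}

/-- The parts `(1^{a_{-1}}, e^{a_0}, (ep)^{a_1}, …, (ep^t)^{a_t})` of the standard maximal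
`e`-`p`-parabolic composition of `n = a_{-1} + a_0 e + a_1 ep + ⋯ + a_t ep^t`, where
`0 ≤ a_{-1} < e` and `0 ≤ a_i < p` for `i ≥ 0`.
For `p = 0` there are no parts `ep^i` with `i ≥ 1`, and `a_0` is unrestricted. -/
def stdMaxParts (e p n : ℕ) : List ℕ :=
  List.replicate (n % e) 1 ++
    if p = 0 then List.replicate (n / e) e
    else ((p.digits (n / e)).mapIdx fun i a => List.replicate a (e * p ^ i)).flatten

theorem sum_flatten_digits (p : ℕ) (l : List ℕ) (e : ℕ) :
    ((l.mapIdx fun i a => List.replicate a (e * p ^ i)).flatten).sum = e * Nat.ofDigits p l := by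
  induction l generalizing e with
  | nil => simp
  | cons a l ih =>
    have h : (l.mapIdx fun i a => List.replicate a (e * p ^ (i + 1))) =
        l.mapIdx fun i a => List.replicate a ((e * p) * p ^ i) := by
      congr 1; funext i a; congr 1; ring
    rw [List.mapIdx_cons, List.flatten_cons, List.sum_append, h, ih, Nat.ofDigits_cons]
    simp
    ring

/-- The standard maximal `e`-`p`-parabolic composition of `n`. -/
def stdMaxComposition (e p n : ℕ) (he : 0 < e) : Composition n where
  blocks := stdMaxParts e p n
  blocks_pos := by
    intro i hi
    unfold stdMaxParts at hi
    rw [List.mem_append] at hi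
    rcases hi with hi | hi
    · rw [List.eq_of_mem_replicate hi]; exact one_pos
    · split_ifs at hi with hp
      · rw [List.eq_of_mem_replicate hi]; exact he
      · obtain ⟨l, hl, hi⟩ := List.mem_flatten.1 hi
        obtain ⟨k, hk, rfl⟩ := List.mem_mapIdx.1 hl
        rw [List.eq_of_mem_replicate hi]
        have : 0 < p := Nat.pos_of_ne_zero hp
        positivity
  blocks_sum := by
    unfold stdMaxParts
    rw [List.sum_append]
    split_ifs with hp
    · simp [mul_comm, Nat.mod_add_div]
    · rw [sum_flatten_digits, Nat.ofDigits_digits]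
      simp [Nat.mod_add_div]

/-- The composition `(e^d) = (e, …, e)` of `de`. -/
def rectComposition (d e : ℕ) (he : 0 < e) : Composition (d * e) where
  blocks := List.replicate d e
  blocks_pos := fun hi => by rw [List.eq_of_mem_replicate hi]; exact he
  blocks_sum := by simp

/-! ## Partitions, dominance and cores

A partition of `n` is a composition of `n` with weakly decreasing parts. -/

/-- The Young diagram of a partition. -/
def partitionDiagram {n : ℕ} (mu : Composition n) (hmu : mu.blocks.SortedGE) : YoungDiagram :=
  YoungDiagram.ofRowLens mu.blocks hmu

/-- `nu` strictly dominates `mu`. -/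
def StrictlyDominates {n : ℕ} (nu mu : Composition n) : Prop :=
  nu ≠ mu ∧ ∀ k, mu.sizeUpTo k ≤ nu.sizeUpTo k

/-- `rho` is obtained from `lam` by removing an `a`-hook, that is, a chain of `a` boxes in which
each box lies directly below or directly to the left of the preceding one. (Boxes are pairs
(row, column). As `rho` is again a diagram, such a chain lies on the rim of `lam`.) -/
def RemovesHook (a : ℕ) (lam rho : YoungDiagram) : Prop :=
  rho ≤ lam ∧ ∃ l : List (ℕ × ℕ), l.length = a ∧
    l.IsChain (fun x y => y = (x.1 + 1, x.2) ∨ (y.1 = x.1 ∧ y.2 + 1 = x.2)) ∧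
    ∀ x, x ∈ l ↔ x ∈ lam ∧ x ∉ rho

/-- `rho` is the `a`-core of `lam`: it is reached by removing `a`-hooks one after the other, until
no more can be removed. -/
def IsCoreOf (a : ℕ) (lam rho : YoungDiagram) : Prop :=
  Relation.ReflTransGen (RemovesHook a) lam rho ∧ ∀ sig, ¬ RemovesHook a rho sig

/-! ## Specht modules -/

section Specht

variable {F : Type u} [Field F] (q : F) {n : ℕ}

open Classical in
/-- `m_mu`, the sum of the `T_w` with `w ∈ S_mu`. -/
def murphyElement (mu : Composition n) : HeckeAlgebra F q n :=
  ∑ w : Equiv.Perm (Fin n) with w ∈ parabolicSubgroup mu, HeckeAlgebra.T q w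

/-- The two-sided ideal generated by the `m_nu` for the partitions `nu` of `n` that strictly
dominate `mu`, as a submodule of the right regular module. (It is the span of the Murphy basis
elements `m_{uv} = T_{d(u)^{-1}} m_nu T_{d(v)}`, for standard tableaux `u`, `v` of such a
shape `nu`.) -/
def dominatingIdeal (mu : Composition n) :
    Submodule (HeckeAlgebra F q n)ᵐᵒᵖ (HeckeAlgebra F q n) :=
  Submodule.span _ {x | ∃ nu : Composition n, nu.blocks.SortedGE ∧ StrictlyDominates nu mu ∧
    ∃ a : HeckeAlgebra F q n, x = a * murphyElement q nu}

/-- The Specht module `S^mu`: the right submodule of the quotient of `H_n` by the ideal above that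
is generated by the class of `m_mu`. A right module is a module over the opposite algebra. -/
def spechtModule (mu : Composition n) :
    Submodule (HeckeAlgebra F q n)ᵐᵒᵖ (HeckeAlgebra F q n ⧸ dominatingIdeal q mu) :=
  Submodule.span _ {(dominatingIdeal q mu).mkQ (murphyElement q mu)}

end Specht

/-! ## Bimodules, relative projectivity and blocks

An `(A, A)`-bimodule over `F` is a left module over `A ⊗ Aᵒᵖ`; the element `a ⊗ bᵒᵖ` acts
as `m ↦ a m b`. -/

/-- The enveloping algebra `A ⊗ Aᵒᵖ`. -/
abbrev Env (F A : Type u) [Field F] [Ring A] [Algebra F A] : Type u := A ⊗[F] Aᵐᵒᵖ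

section Bimodules

variable {F A : Type u} [Field F] [Ring A] [Algebra F A]

/-- `A` as an `(A, A)`-bimodule. -/
instance regularBimodule : Module (Env F A) A := TensorProduct.Algebra.module

instance regularBimodule_isScalarTower : IsScalarTower F (Env F A) A where
  smul_assoc r x a := by
    change TensorProduct.Algebra.moduleAux _ _ = _ • TensorProduct.Algebra.moduleAux _ _
    simp

/-- `M | N`: the module `M` is isomorphic to a direct summand of `N`. -/
def IsIsoToDirectSummand (R M N : Type u) [Ring R] [AddCommGroup M] [Module R M]
    [AddCommGroup N] [Module R N] : Prop :=
  ∃ P Q : Submodule R N, IsCompl P Q ∧ Nonempty (M ≃ₗ[R] P)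

/-- The `A`-module `M` is relatively projective with respect to the subalgebra `A'`: for
`A`-linear maps `α : M → W` and `β : V → W` with `β` onto, if `α` lifts along `β` to an
`A'`-linear map then it lifts to an `A`-linear map. -/
def IsRelativelyProjective (A' : Subalgebra F A) (M : Type u) [AddCommGroup M] [Module A M] :
    Prop :=
  ∀ (V W : Type u) [AddCommGroup V] [Module A V] [AddCommGroup W] [Module A W]
    (α : M →ₗ[A] W) (β : V →ₗ[A] W), Function.Surjective β →
    (∃ γ : M →ₗ[A'] V, ∀ m, β (γ m) = α m) → ∃ δ : M →ₗ[A] V, ∀ m, β (δ m) = α m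

/-- The subalgebra `A' ⊗ (B')ᵒᵖ` of `A ⊗ Aᵒᵖ`. -/
def envSubalgebra (A' B' : Subalgebra F A) : Subalgebra F (Env F A) :=
  (Algebra.TensorProduct.map A'.val B'.op.val).range

/-- The `(A, A)`-bimodule `M` is relatively `(A', B')`-projective. -/
def IsRelativelyProjectiveBimodule (A' B' : Subalgebra F A) (M : Type u) [AddCommGroup M]
    [Module (Env F A) M] : Prop :=
  IsRelativelyProjective (envSubalgebra A' B') M

section TensorOver

variable (F A) (M N : Type u) [AddCommGroup M] [Module F M] [Module (Env F A) M]
  [IsScalarTower F (Env F A) M] [AddCommGroup N] [Module F N] [Module (Env F A) N]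
  [IsScalarTower F (Env F A) N]

/-- `M ⊗_F N` for bimodules `M` and `N`, to carry the outer bimodule structure. -/
def OuterTensor : Type u := M ⊗[F] N

instance : AddCommGroup (OuterTensor F M N) := inferInstanceAs (AddCommGroup (M ⊗[F] N))

/-- The left action of `A` on a bimodule, `m ↦ a m`. -/
def leftAction : A →ₐ[F] Module.End F M :=
  (Algebra.lsmul F F M).comp (Algebra.TensorProduct.includeLeft : A →ₐ[F] Env F A)

/-- The right action of `A` on a bimodule, `m ↦ m b`. -/
def rightAction : Aᵐᵒᵖ →ₐ[F] Module.End F M :=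
  (Algebra.lsmul F F M).comp (Algebra.TensorProduct.includeRight : Aᵐᵒᵖ →ₐ[F] Env F A)

/-- The outer bimodule structure: `a ⊗ bᵒᵖ` acts on `M ⊗_F N` by `m ⊗ n ↦ a m ⊗ n b`. -/
def outerAction : Env F A →ₐ[F] Module.End F (M ⊗[F] N) :=
  Algebra.TensorProduct.lift
    ((Module.End.rTensorAlgHom F M N).comp (leftAction F A M))
    ((Module.End.lTensorAlgHom F N M).comp (rightAction F A N))
    (fun a b => by
      change (leftAction F A M a).rTensor N ∘ₗ (rightAction F A N b).lTensor M =
        (rightAction F A N b).lTensor M ∘ₗ (leftAction F A M a).rTensor N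
      rw [LinearMap.rTensor_comp_lTensor, LinearMap.lTensor_comp_rTensor])

theorem outerAction_tmul (a : A) (b : Aᵐᵒᵖ) (m : M) (n : N) :
    outerAction F A M N (a ⊗ₜ[F] b) (m ⊗ₜ[F] n) =
      ((a ⊗ₜ[F] (1 : Aᵐᵒᵖ) : Env F A) • m) ⊗ₜ[F] (((1 : A) ⊗ₜ[F] b : Env F A) • n) := by
  rw [outerAction, Algebra.TensorProduct.lift_tmul]
  rfl

instance : Module (Env F A) (OuterTensor F M N) :=
  Module.compHom (M ⊗[F] N) (outerAction F A M N).toRingHom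

/-- The elements `m a ⊗ n - m ⊗ a n` with `a ∈ A'`. Together they generate a sub-bimodule. -/
def balancingSubmodule (A' : Subalgebra F A) : Submodule (Env F A) (OuterTensor F M N) :=
  Submodule.span (Env F A) {x | ∃ (m : M) (a : A) (n : N), a ∈ A' ∧
    x = (((1 : A) ⊗ₜ[F] MulOpposite.op a : Env F A) • m) ⊗ₜ[F] n -
      m ⊗ₜ[F] ((a ⊗ₜ[F] (1 : Aᵐᵒᵖ) : Env F A) • n)}

/-- The `(A, A)`-bimodule `M ⊗_{A'} N`. -/
abbrev TensorOver (A' : Subalgebra F A) : Type u :=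
  OuterTensor F M N ⧸ balancingSubmodule F A M N A'

end TensorOver

/-- `f` is a primitive central idempotent of `A`. -/
structure IsBlockIdempotent (f : A) : Prop where
  idem : f * f = f
  central : ∀ a, f * a = a * f
  ne_zero : f ≠ 0
  primitive : ∀ g : A, g * g = g → (∀ a, g * a = a * g) → f * g = g → g = 0 ∨ g = f

/-- The block `B = AfA = Af` of `A` with central idempotent `f`, as an `(A, A)`-bimodule. -/
def blockBimodule (F : Type u) {A : Type u} [Field F] [Ring A] [Algebra F A] (f : A) :
    Submodule (Env F A) A :=
  Submodule.span (Env F A) {f}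

end Bimodules

/-- `f` is the central idempotent of the block of `H_n` with empty `e`-core, that is, of the block
to which all Specht modules `S^mu` with `mu` a partition of `n` with empty `e`-core belong.
(`S^mu` belongs to the block when `f` acts on it, from the right, as the identity.) -/
structure IsEmptyCoreBlockIdempotent {F : Type u} [Field F] (q : F) (e : ℕ) {n : ℕ}
    (f : HeckeAlgebra F q n) : Prop where
  isBlock : IsBlockIdempotent f
  specht : ∀ (mu : Composition n) (hmu : mu.blocks.SortedGE),
    IsCoreOf e (partitionDiagram mu hmu) ⊥ →
      ∀ x ∈ spechtModule q mu, MulOpposite.op f • x = x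

end

/-! Everything rests on a Higman-type averaging argument. On a bimodule over the Hecke algebra H put
σ_k(m) = q⁻¹ T_k m T_k and δ_k(m) = T_k m - m T_k. Summing products of the σ_k over distinguished
coset representatives gives a relative trace. `IsTransferSeq.delta_mul_relTrace` shows, inside the
enveloping algebra and hence for all bimodules at once, that it carries vectors centralised by a
parabolic subalgebra to vectors centralised by H. Suppose an operator w has this property for H_λ
and fixes the block idempotent f. Then an H_λ-bilinear lift γ of a bimodule map on B may be replaced
by the bimodule map f ↦ w γ(f), and f ↦ w (f ⊗ f) splits the multiplication B ⊗_{H_λ} B → B.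

For the block with empty core, w is the iterated relative trace t from S_λ, corrected by a central
factor inverting t · 1 in B. The centre of B is local, so t · 1 is invertible in B once one
character of B does not kill it. The sign character T_i ↦ -1 belongs to B because the column
(1^{de}) has empty e-core. It turns each σ_k into the scalar q⁻¹, so its value on t · 1 is a
Gaussian multinomial coefficient at q⁻¹. The q-binomial theorem and Lucas' congruence show that this
is nonzero precisely because the parts of λ come from the p-adic digits of d.

The sign character sees only one block, so the statement on the whole algebra in characteristic 0
needs another source of invertible traces. The identity `IsHeckeSeq.sum_relTrace_smul_jmProd` says
that, modulo traces from proper maximal parabolics, ∏ (1 - c L_i) = 1 - c^n for all scalars c, where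
the L_i are the Jucys-Murphy elements. If those traces lay in a maximal ideal of the centre, the L_i
would specialise to the n distinct n-th roots of unity. But the specialisations are also e-th roots
of unity, and that of L_1 is q or q⁻¹, which forces n = e. So for 1 < n ≠ e the traces generate the
unit ideal (`traceIdeal_eq_top`), and induction on the parabolic subgroups reaches (e^d)
(`isTransferable_rect`). -/

noncomputable section

/-! ## Relative traces in the braid monoid -/

section RelativeTrace

variable {E : Type*} [Ring E]

/-- The descending product `σ (a + l - 1) ⋯ σ (a + 1) σ a` of `l` factors. -/
def descProd (σ : ℕ → E) (a : ℕ) : ℕ → E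
  | 0 => 1
  | l + 1 => σ (a + l) * descProd σ a l

/-- The sum, over the distinguished coset representatives `w` of `S_a × S_b` in `S_{a+b}`, of the
products of the `σ i` along reduced expressions. -/
def relTrace (σ : ℕ → E) : ℕ → ℕ → E
  | 0, _ => 1
  | _ + 1, 0 => 1
  | a + 1, b + 1 => relTrace σ (a + 1) b + relTrace σ a (b + 1) * descProd σ a (b + 1)

@[simp] theorem descProd_zero (σ : ℕ → E) (a : ℕ) : descProd σ a 0 = 1 := rfl

theorem descProd_succ (σ : ℕ → E) (a l : ℕ) :
    descProd σ a (l + 1) = σ (a + l) * descProd σ a l := rfl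

@[simp] theorem relTrace_zero_left (σ : ℕ → E) (b : ℕ) : relTrace σ 0 b = 1 := by
  cases b <;> simp [relTrace]

@[simp] theorem relTrace_zero_right (σ : ℕ → E) (a : ℕ) : relTrace σ a 0 = 1 := by
  cases a <;> simp [relTrace]

theorem relTrace_succ_succ (σ : ℕ → E) (a b : ℕ) :
    relTrace σ (a + 1) (b + 1) =
      relTrace σ (a + 1) b + relTrace σ a (b + 1) * descProd σ a (b + 1) := by
  simp [relTrace]

theorem relTrace_succ_one (σ : ℕ → E) (a : ℕ) :
    relTrace σ (a + 1) 1 = 1 + relTrace σ a 1 * σ a := by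
  simp [relTrace_succ_succ, descProd_succ]

theorem descProd_succ_right (σ : ℕ → E) (a l : ℕ) :
    descProd σ a (l + 1) = descProd σ (a + 1) l * σ a := by
  induction l with
  | zero => simp [descProd_succ]
  | succ l ih =>
    rw [descProd_succ, ih, descProd_succ, mul_assoc, show a + (l + 1) = a + 1 + l by omega]

theorem descProd_congr {σ τ : ℕ → E} {a l : ℕ} (h : ∀ k, a ≤ k → k < a + l → σ k = τ k) :
    descProd σ a l = descProd τ a l := by
  induction l with
  | zero => rfl
  | succ l ih =>
    rw [descProd_succ, descProd_succ, h _ (by omega) (by omega),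
      ih fun k h1 h2 => h k h1 (by omega)]

theorem relTrace_congr {σ τ : ℕ → E} : ∀ {a b : ℕ}, (∀ k, k + 1 < a + b → σ k = τ k) →
    relTrace σ a b = relTrace τ a b
  | 0, _, _ => by simp
  | _ + 1, 0, _ => by simp
  | a + 1, b + 1, h => by
    rw [relTrace_succ_succ, relTrace_succ_succ, relTrace_congr fun k hk => h k (by omega),
      relTrace_congr (a := a) fun k hk => h k (by omega),
      descProd_congr fun k h1 h2 => h k (by omega)]

theorem commute_descProd {σ : ℕ → E} {x : E} {a l : ℕ}
    (h : ∀ k, a ≤ k → k < a + l → Commute x (σ k)) : Commute x (descProd σ a l) := by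
  induction l with
  | zero => exact Commute.one_right x
  | succ l ih =>
    exact (h _ (by omega) (by omega)).mul_right (ih fun k h1 h2 => h k h1 (by omega))

theorem commute_relTrace {σ : ℕ → E} {x : E} : ∀ {a b : ℕ},
    (∀ k, k + 1 < a + b → Commute x (σ k)) → Commute x (relTrace σ a b)
  | 0, _, _ => by simp
  | _ + 1, 0, _ => by simp
  | a + 1, b + 1, h => by
    rw [relTrace_succ_succ]
    exact (commute_relTrace fun k hk => h k (by omega)).add_right
      ((commute_relTrace fun k hk => h k (by omega)).mul_right
        (commute_descProd fun k h1 h2 => h k (by omega)))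

theorem map_descProd {E' : Type*} [Ring E'] (f : E →+* E') (σ : ℕ → E) (a l : ℕ) :
    f (descProd σ a l) = descProd (fun k => f (σ k)) a l := by
  induction l with
  | zero => simp
  | succ l ih => rw [descProd_succ, descProd_succ, map_mul, ih]

theorem map_relTrace {E' : Type*} [Ring E'] (f : E →+* E') (σ : ℕ → E) : ∀ a b : ℕ,
    f (relTrace σ a b) = relTrace (fun k => f (σ k)) a b
  | 0, _ => by simp
  | _ + 1, 0 => by simp
  | a + 1, b + 1 => by
    rw [relTrace_succ_succ, relTrace_succ_succ, map_add, map_mul, map_descProd,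
      map_relTrace f σ (a + 1) b, map_relTrace f σ a (b + 1)]

/-- Moving an element through a descending product raises its index. -/
theorem mul_descProd_of_up {σ x : ℕ → E}
    (hcomm : ∀ i j, i + 2 ≤ j ∨ j + 2 ≤ i → Commute (x i) (σ j))
    (hup : ∀ k, x k * (σ (k + 1) * σ k) = σ (k + 1) * σ k * x (k + 1)) {a l j : ℕ}
    (h1 : a ≤ j) (h2 : j + 1 < a + l) : x j * descProd σ a l = descProd σ a l * x (j + 1) := by
  induction l with
  | zero => omega
  | succ l ih =>
    rcases Nat.lt_or_ge (j + 1) (a + l) with h | h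
    · rw [descProd_succ, ← mul_assoc, (hcomm j (a + l) (by omega)).eq, mul_assoc, ih h, mul_assoc]
    · obtain ⟨l, rfl⟩ : ∃ l', l = l' + 1 := ⟨l - 1, by omega⟩
      obtain rfl : j = a + l := by omega
      rw [descProd_succ, descProd_succ, ← mul_assoc (σ _), ← mul_assoc, ← add_assoc, hup,
        mul_assoc _ (x _), (commute_descProd fun k _ hk => hcomm _ k (by omega)).eq, ← mul_assoc]

/-- The relations between the conjugation operators `σ i` and the commutators `δ i`. -/
structure IsTransferSeq (σ δ : ℕ → E) : Prop where
  comm : ∀ i j, i + 2 ≤ j → Commute (σ i) (σ j)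
  braid : ∀ k, σ k * σ (k + 1) * σ k = σ (k + 1) * σ k * σ (k + 1)
  comm_delta : ∀ i j, i + 2 ≤ j ∨ j + 2 ≤ i → Commute (δ i) (σ j)
  delta_mul_one_add : ∀ k, δ k * (1 + σ k) = 0
  delta_up : ∀ k, δ k * (σ (k + 1) * σ k) = σ (k + 1) * σ k * δ (k + 1)
  delta_down : ∀ k, δ (k + 1) * (σ k * σ (k + 1)) = σ k * σ (k + 1) * δ k

namespace IsTransferSeq

variable {σ δ : ℕ → E}

theorem comm' (h : IsTransferSeq σ δ) (i j : ℕ) (hij : i + 2 ≤ j ∨ j + 2 ≤ i) :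
    Commute (σ i) (σ j) :=
  hij.elim (h.comm i j) fun hij => (h.comm j i hij).symm

theorem delta_mul_descProd (h : IsTransferSeq σ δ) {a l j : ℕ} (h1 : a ≤ j) (h2 : j + 1 < a + l) :
    δ j * descProd σ a l = descProd σ a l * δ (j + 1) :=
  mul_descProd_of_up h.comm_delta h.delta_up h1 h2

theorem sigma_mul_descProd (h : IsTransferSeq σ δ) {a l j : ℕ} (h1 : a ≤ j) (h2 : j + 1 < a + l) :
    σ j * descProd σ a l = descProd σ a l * σ (j + 1) :=
  mul_descProd_of_up h.comm' (fun k => by rw [← mul_assoc]; exact h.braid k) h1 h2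

/-- The two descending products regroup into the factors σ (a+i) σ (a+i+1), which carry two adjacent
strands together past `l` others. Each factor lowers the index of `δ` by one through `delta_down`.
-/
theorem delta_mul_descProd_mul_descProd (h : IsTransferSeq σ δ) (a l : ℕ) :
    δ (a + l) * (descProd σ a l * descProd σ (a + 1) l) =
      descProd σ a l * descProd σ (a + 1) l * δ a := by
  induction l with
  | zero => simp
  | succ l ih =>
    have hc : descProd σ a l * σ (a + l + 1) = σ (a + l + 1) * descProd σ a l :=
      (commute_descProd fun k _ hk => (h.comm' _ k (by omega))).eq.symm
    have hY : descProd σ a (l + 1) * descProd σ (a + 1) (l + 1) =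
        σ (a + l) * σ (a + l + 1) * (descProd σ a l * descProd σ (a + 1) l) := by
      rw [descProd_succ, descProd_succ, show a + 1 + l = a + l + 1 by omega, mul_assoc,
        ← mul_assoc (descProd σ a l), hc]
      simp only [mul_assoc]
    rw [hY, ← mul_assoc, ← add_assoc, h.delta_down, mul_assoc, ih, ← mul_assoc]

/-- Elements invariant under `S_a × S_b` are sent by the relative trace to elements invariant under
`S_{a+b}`. -/
theorem delta_mul_relTrace (h : IsTransferSeq σ δ) : ∀ {a b k : ℕ}, k + 1 < a + b →
    δ k * relTrace σ a b ∈ Ideal.span (δ '' {k | k + 1 < a + b ∧ k + 1 ≠ a})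
  | 0, b, k, hk => by
    rw [relTrace_zero_left, mul_one]
    exact Ideal.subset_span ⟨k, ⟨hk, by omega⟩, rfl⟩
  | a + 1, 0, k, hk => by
    rw [relTrace_zero_right, mul_one]
    exact Ideal.subset_span ⟨k, ⟨hk, by omega⟩, rfl⟩
  | a + 1, b + 1, k, hk => by
    have hmem : ∀ x j, j + 1 < a + 1 + (b + 1) ∧ j + 1 ≠ a + 1 →
        x * δ j ∈ Ideal.span (δ '' {k | k + 1 < a + 1 + (b + 1) ∧ k + 1 ≠ a + 1}) :=
      fun x j hj => Ideal.mul_mem_left _ _ (Ideal.subset_span ⟨j, hj, rfl⟩)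
    rcases Nat.lt_or_ge (k + 1) (a + b + 1) with hk' | hk'
    · rw [relTrace_succ_succ, mul_add, ← mul_assoc]
      refine add_mem (Ideal.span_mono (Set.image_mono fun j hj => ?_)
        (h.delta_mul_relTrace (a := a + 1) (b := b) (k := k) (by omega))) ?_
      · exact ⟨by have := hj.1; omega, hj.2⟩
      · have hk2 := h.delta_mul_relTrace (a := a) (b := b + 1) (k := k) (by omega)
        generalize δ k * relTrace σ a (b + 1) = z at hk2
        induction hk2 using Submodule.span_induction with
        | mem x hx =>
          obtain ⟨j, ⟨hj1, hj2⟩, rfl⟩ := hx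
          rcases Nat.lt_or_ge j a with hja | hja
          · rw [(commute_descProd fun i _ _ => h.comm_delta j i (by omega)).eq]
            exact hmem _ _ ⟨by omega, by omega⟩
          · rw [h.delta_mul_descProd hja (by omega)]
            exact hmem _ _ ⟨by omega, by omega⟩
        | zero => rw [zero_mul]; exact zero_mem _
        | add x y _ _ hx hy => rw [add_mul]; exact add_mem hx hy
        | smul c x _ hx => rw [smul_eq_mul, mul_assoc]; exact Ideal.mul_mem_left _ _ hx
    · obtain rfl : k = a + b := by omega
      -- The last index k = a + b is the only one not covered by induction. Unfolding the recursion
      -- once more on each side isolates R D and R σ (a+b) D, with R = `relTrace σ a b` and D =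
      -- `descProd σ a b`. They combine to R (1 + σ (a+b)) D, which δ (a+b) kills. The remainders p'
      -- and r' are treated by commutation and by the two-strand move.
      obtain ⟨p', hp, hp'⟩ : ∃ p', relTrace σ (a + 1) b = p' + relTrace σ a b * descProd σ a b ∧
          δ (a + b) * p' ∈ Ideal.span (δ '' {k | k + 1 < a + 1 + (b + 1) ∧ k + 1 ≠ a + 1}) := by
        rcases b with _ | b
        · exact ⟨0, by simp, by simp⟩
        · refine ⟨relTrace σ (a + 1) b, relTrace_succ_succ _ _ _, ?_⟩
          rw [(commute_relTrace fun i hi => h.comm_delta _ i (by omega)).eq]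
          exact hmem _ _ ⟨by omega, by omega⟩
      obtain ⟨r', hr, hr'⟩ : ∃ r', relTrace σ a (b + 1) = relTrace σ a b + r' ∧
          δ (a + b) * (r' * descProd σ a (b + 1)) ∈
            Ideal.span (δ '' {k | k + 1 < a + 1 + (b + 1) ∧ k + 1 ≠ a + 1}) := by
        rcases a with _ | a
        · exact ⟨0, by simp, by simp⟩
        · refine ⟨relTrace σ a (b + 1) * descProd σ a (b + 1), relTrace_succ_succ _ _ _, ?_⟩
          rw [mul_assoc, ← mul_assoc, (commute_relTrace fun i hi => h.comm_delta _ i (by omega)).eq,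
            mul_assoc, show a + 1 + b = a + (b + 1) by omega,
            h.delta_mul_descProd_mul_descProd, ← mul_assoc]
          exact hmem _ _ ⟨by omega, by omega⟩
      have key : δ (a + b) * relTrace σ (a + 1) (b + 1) =
          δ (a + b) * p' + δ (a + b) * (r' * descProd σ a (b + 1)) := by
        have h0 : δ (a + b) * (relTrace σ a b * ((1 + σ (a + b)) * descProd σ a b)) = 0 := by
          rw [← mul_assoc, (commute_relTrace fun i hi => h.comm_delta _ i (by omega)).eq, mul_assoc,
            ← mul_assoc (δ _), h.delta_mul_one_add, zero_mul, mul_zero]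
        rw [relTrace_succ_succ, hp, hr, ← mul_add, ← add_zero (δ (a + b) * (p' + _)), ← h0, ← mul_add,
          descProd_succ]
        congr 1
        noncomm_ring
      rw [key]
      exact add_mem hp' hr'

/-- The two ways to factor the relative trace from `S_p × S_b × S_1` to `S_{p+b+1}` agree. -/
theorem relTrace_mul_relTrace (h : IsTransferSeq σ δ) : ∀ p b : ℕ,
    relTrace σ p (b + 1) * relTrace (fun k => σ (p + k)) b 1 =
      relTrace σ (p + b) 1 * relTrace σ p b
  | 0, b => by simp
  | p + 1, 0 => by simp
  | p + 1, b + 1 => by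
    have h1 := h.relTrace_mul_relTrace (p + 1) b
    have h2 := h.relTrace_mul_relTrace p (b + 1)
    have hc1 : relTrace σ (p + 1) b * σ (p + 1 + b) = σ (p + 1 + b) * relTrace σ (p + 1) b :=
      (commute_relTrace fun k hk => h.comm' _ k (by omega)).eq.symm
    have hc2 : relTrace σ p (b + 1) * σ (p + 1 + b) = σ (p + 1 + b) * relTrace σ p (b + 1) :=
      (commute_relTrace fun k hk => h.comm' _ k (by omega)).eq.symm
    -- Passing the descending product across shifts every σ index by one, so the trace based at p +
    -- 1 becomes the one based at p.
    have hs : ∀ c ≤ b + 1, descProd σ p (b + 2) * relTrace (fun k => σ (p + 1 + k)) c 1 =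
        relTrace (fun k => σ (p + k)) c 1 * descProd σ p (b + 2) := by
      intro c hc
      induction c with
      | zero => simp
      | succ c ih =>
        rw [relTrace_succ_one, relTrace_succ_one, mul_add, add_mul, ← mul_assoc, ih (by omega),
          mul_assoc, mul_assoc, h.sigma_mul_descProd (by omega) (by omega)]
        simp [show p + 1 + c = p + c + 1 by omega]
    calc _ = relTrace σ (p + 1) (b + 1) * (1 + relTrace (fun k => σ (p + 1 + k)) b 1 *
            σ (p + 1 + b)) + relTrace σ p (b + 2) * relTrace (fun k => σ (p + k)) (b + 1) 1 *
              descProd σ p (b + 2) := by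
          rw [relTrace_succ_succ σ p (b + 1), add_mul, mul_assoc _ (descProd _ _ _), hs _ le_rfl,
            ← relTrace_succ_one, mul_assoc]
      _ = relTrace σ (p + 1) (b + 1) + relTrace σ (p + 1 + b) 1 * σ (p + 1 + b) *
            (relTrace σ (p + 1) b + relTrace σ p (b + 1) * descProd σ p (b + 1)) := by
          rw [h2, mul_add, mul_one, ← mul_assoc (relTrace σ (p + 1) (b + 1)), h1, descProd_succ,
            show p + (b + 1) = p + 1 + b by omega, mul_assoc, hc1, mul_assoc (relTrace σ _ 1)
            (relTrace σ p (b + 1)), ← mul_assoc (relTrace σ p (b + 1)), hc2]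
          noncomm_ring
      _ = _ := by
          rw [← relTrace_succ_succ, ← add_assoc, relTrace_succ_one]
          noncomm_ring

end IsTransferSeq

end RelativeTrace

/-! ## Hecke sequences and the operators they define -/

section HeckeSequence

variable {F A : Type u} [Field F] [Ring A] [Algebra F A]

/-- A sequence of elements that satisfies the relations of the generators of the Hecke algebra of
`S_n`, continued by `0`. -/
structure IsHeckeSeq (q : F) (n : ℕ) (g : ℕ → A) : Prop where
  comm : ∀ i j, i + 2 ≤ j → Commute (g i) (g j)
  braid : ∀ k, g k * g (k + 1) * g k = g (k + 1) * g k * g (k + 1)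
  quadratic : ∀ k, k + 1 < n → g k * g k = (q - 1) • g k + q • 1
  eq_zero : ∀ k, n ≤ k + 1 → g k = 0

theorem env_tmul_smul (a b x : A) :
    (a ⊗ₜ[F] MulOpposite.op b : Env F A) • x = a * x * b := by
  change TensorProduct.Algebra.moduleAux _ _ = _
  rw [TensorProduct.Algebra.moduleAux_apply]
  simp [mul_assoc]

/-- The operator `m ↦ q⁻¹ g_k m g_k` on bimodules. -/
def conjOp (q : F) (g : ℕ → A) (k : ℕ) : Env F A :=
  q⁻¹ • (g k ⊗ₜ[F] MulOpposite.op (g k))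

/-- The operator `m ↦ g_k m - m g_k` on bimodules. -/
def commOp (F : Type u) [Field F] [Algebra F A] (g : ℕ → A) (k : ℕ) : Env F A :=
  g k ⊗ₜ[F] 1 - 1 ⊗ₜ[F] MulOpposite.op (g k)

theorem conjOp_smul (q : F) (g : ℕ → A) (k : ℕ) (x : A) :
    conjOp q g k • x = q⁻¹ • (g k * x * g k) := by
  rw [conjOp, smul_assoc, env_tmul_smul]

theorem commOp_smul (g : ℕ → A) (k : ℕ) (x : A) :
    commOp F g k • x = g k * x - x * g k := by
  rw [commOp, sub_smul, ← MulOpposite.op_one, env_tmul_smul, env_tmul_smul]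
  simp

namespace IsHeckeSeq

variable {q : F} {n : ℕ} {g : ℕ → A}

theorem comm' (h : IsHeckeSeq q n g) (i j : ℕ) (hij : i + 2 ≤ j ∨ j + 2 ≤ i) :
    Commute (g i) (g j) :=
  hij.elim (h.comm i j) fun hij => (h.comm j i hij).symm

/-- The braid-type relations hold in each tensor leg separately. Only `delta_mul_one_add` uses the
quadratic relation: in T m - m T + q⁻¹ (T² m T - T m T²) the terms with T m T cancel and the rest is
T m - m T + m T - T m = 0. -/
theorem isTransferSeq (h : IsHeckeSeq q n g) (hq : q ≠ 0) :
    IsTransferSeq (conjOp q g) (commOp F g) where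
  comm i j hij := by
    have := (h.comm i j hij).eq
    simp only [Commute, SemiconjBy, conjOp, smul_mul_smul_comm, Algebra.TensorProduct.tmul_mul_tmul,
      ← MulOpposite.op_mul, this]
  braid k := by
    simp only [conjOp, smul_mul_smul_comm, Algebra.TensorProduct.tmul_mul_tmul,
      ← MulOpposite.op_mul, h.braid, ← mul_assoc]
  comm_delta i j hij := by
    have := (h.comm' i j hij).eq
    simp only [Commute, SemiconjBy, conjOp, commOp, mul_smul_comm, smul_mul_assoc,
      Algebra.TensorProduct.tmul_mul_tmul, sub_mul, mul_sub, one_mul, mul_one,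
      ← MulOpposite.op_mul, this, smul_sub]
  delta_mul_one_add k := by
    rcases Nat.lt_or_ge (k + 1) n with hk | hk
    · have h2 := h.quadratic k hk
      simp only [conjOp, commOp, mul_add, mul_smul_comm, mul_one, sub_mul, one_mul,
        Algebra.TensorProduct.tmul_mul_tmul, ← MulOpposite.op_mul, h2, MulOpposite.op_add,
        MulOpposite.op_smul, MulOpposite.op_one, TensorProduct.add_tmul, TensorProduct.tmul_add,
        ← TensorProduct.smul_tmul', TensorProduct.tmul_smul]
      match_scalars <;> field_simp <;> ring
    · simp [commOp, h.eq_zero k hk]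
  delta_up k := by
    simp only [conjOp, commOp, mul_smul_comm, smul_mul_assoc,
      Algebra.TensorProduct.tmul_mul_tmul, sub_mul, mul_sub, one_mul, mul_one,
      ← MulOpposite.op_mul, ← mul_assoc, h.braid, smul_sub]
  delta_down k := by
    simp only [conjOp, commOp, mul_smul_comm, smul_mul_assoc,
      Algebra.TensorProduct.tmul_mul_tmul, sub_mul, mul_sub, one_mul, mul_one,
      ← MulOpposite.op_mul, ← mul_assoc, h.braid, smul_sub]

end IsHeckeSeq

/-- Multiplication by an element that commutes with both tensor factors passes through the
action. -/
theorem env_smul_mul_left {w : Env F A} {z : A} (hw : Commute (z ⊗ₜ[F] 1 : Env F A) w) (x : A) :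
    w • (z * x) = z * w • x := by
  have h1 : ∀ y : A, z * y = (z ⊗ₜ[F] 1 : Env F A) • y := fun y => by
    rw [← MulOpposite.op_one, env_tmul_smul, mul_one]
  rw [h1, h1, smul_smul, smul_smul, hw.eq]

theorem env_smul_mul_right {w : Env F A} {z : A}
    (hw : Commute (1 ⊗ₜ[F] MulOpposite.op z : Env F A) w) (x : A) :
    w • (x * z) = w • x * z := by
  have h1 : ∀ y : A, y * z = (1 ⊗ₜ[F] MulOpposite.op z : Env F A) • y := fun y => by
    rw [env_tmul_smul, one_mul]
  rw [h1, h1, smul_smul, smul_smul, hw.eq]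

theorem commute_tmul_one_conjOp (q : F) {g : ℕ → A} {z : A} {k : ℕ} (h : Commute z (g k)) :
    Commute (z ⊗ₜ[F] 1 : Env F A) (conjOp q g k) := by
  simp only [Commute, SemiconjBy, conjOp, mul_smul_comm, smul_mul_assoc,
    Algebra.TensorProduct.tmul_mul_tmul, h.eq, one_mul, mul_one]

theorem commute_one_tmul_conjOp (q : F) {g : ℕ → A} {z : A} {k : ℕ} (h : Commute z (g k)) :
    Commute (1 ⊗ₜ[F] MulOpposite.op z : Env F A) (conjOp q g k) := by
  simp only [Commute, SemiconjBy, conjOp, mul_smul_comm, smul_mul_assoc,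
    Algebra.TensorProduct.tmul_mul_tmul, ← MulOpposite.op_mul, h.eq, one_mul, mul_one]

theorem commute_tmul_one_commOp {g : ℕ → A} {z : A} {k : ℕ} (h : Commute z (g k)) :
    Commute (z ⊗ₜ[F] 1 : Env F A) (commOp F g k) := by
  simp only [Commute, SemiconjBy, commOp, mul_sub, sub_mul,
    Algebra.TensorProduct.tmul_mul_tmul, h.eq, one_mul, mul_one]

/-! ## Jucys-Murphy elements -/

/-- The Jucys-Murphy elements. -/
def jucysMurphy (q : F) (g : ℕ → A) : ℕ → A
  | 0 => 1
  | k + 1 => q⁻¹ • (g k * jucysMurphy q g k * g k)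

/-- The product of the `1 - c L_k` for `k < a`, where the `L_k` are the Jucys-Murphy elements. -/
def jmProd (q : F) (g : ℕ → A) (c : F) : ℕ → A
  | 0 => 1
  | a + 1 => jmProd q g c a * (1 - c • jucysMurphy q g a)

theorem jucysMurphy_succ (q : F) (g : ℕ → A) (k : ℕ) :
    jucysMurphy q g (k + 1) = q⁻¹ • (g k * jucysMurphy q g k * g k) := rfl

theorem jmProd_succ (q : F) (g : ℕ → A) (c : F) (a : ℕ) :
    jmProd q g c (a + 1) = jmProd q g c a * (1 - c • jucysMurphy q g a) := rfl

theorem commute_jucysMurphy {q : F} {g : ℕ → A} {x : A} {i : ℕ}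
    (h : ∀ k < i, Commute x (g k)) : Commute x (jucysMurphy q g i) := by
  induction i with
  | zero => exact Commute.one_right x
  | succ i ih =>
    exact (((h i i.lt_succ_self).mul_right (ih fun k hk => h k (by omega))).mul_right
      (h i i.lt_succ_self)).smul_right _

theorem commute_jmProd {q : F} {g : ℕ → A} {c : F} {x : A} {a : ℕ}
    (h : ∀ k < a, Commute x (jucysMurphy q g k)) : Commute x (jmProd q g c a) := by
  induction a with
  | zero => exact Commute.one_right x
  | succ a ih =>
    exact (ih fun k hk => h k (by omega)).mul_right
      ((Commute.one_right x).sub_right ((h a a.lt_succ_self).smul_right _))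

namespace IsHeckeSeq

variable {q : F} {n : ℕ} {g : ℕ → A}

theorem commute_jucysMurphy_of_lt (h : IsHeckeSeq q n g) {j k : ℕ} (hjk : k < j) :
    Commute (g j) (jucysMurphy q g k) :=
  commute_jucysMurphy fun i hi => h.comm' _ _ (by omega)

theorem commute_jucysMurphy_of_gt (h : IsHeckeSeq q n g) {j k : ℕ} (hjk : j + 1 < k) :
    Commute (g j) (jucysMurphy q g k) := by
  induction k with
  | zero => omega
  | succ k ih =>
    rcases Nat.lt_or_ge (j + 1) k with hk | hk
    · exact (((h.comm j k hk).mul_right (ih hk)).mul_right (h.comm j k hk)).smul_right _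
    · obtain rfl : k = j + 1 := by omega
      rw [jucysMurphy_succ, jucysMurphy_succ]
      refine Commute.smul_right ?_ _
      rw [mul_smul_comm, smul_mul_assoc]
      refine Commute.smul_right ?_ _
      have hc := (h.commute_jucysMurphy_of_lt (j := j + 1) (k := j) (by omega)).eq
      have hb := h.braid j
      generalize jucysMurphy q g j = y at hc
      calc g j * (g (j + 1) * (g j * y * g j) * g (j + 1))
          = (g j * g (j + 1) * g j) * y * g j * g (j + 1) := by noncomm_ring
        _ = g (j + 1) * g j * (g (j + 1) * y) * g j * g (j + 1) := by rw [hb]; noncomm_ring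
        _ = g (j + 1) * g j * y * (g (j + 1) * g j * g (j + 1)) := by rw [hc]; noncomm_ring
        _ = _ := by rw [← hb]; noncomm_ring

/-- For i < j, the element L_i is built from generators g_k with k + 1 < j, and each of these
commutes with L_j. -/
theorem jucysMurphy_comm (h : IsHeckeSeq q n g) (i j : ℕ) :
    Commute (jucysMurphy q g i) (jucysMurphy q g j) := by
  have key : ∀ i j, i < j → Commute (jucysMurphy q g i) (jucysMurphy q g j) := fun i j hij =>
    (commute_jucysMurphy fun k hk => (h.commute_jucysMurphy_of_gt (by omega)).symm).symm
  rcases lt_trichotomy i j with hij | rfl | hij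
  · exact key i j hij
  · exact Commute.refl _
  · exact (key j i hij).symm

theorem gen_mul_jucysMurphy_succ (h : IsHeckeSeq q n g) (hq : q ≠ 0) {k : ℕ} (hk : k + 1 < n) :
    g k * jucysMurphy q g (k + 1) =
      (q - 1) • jucysMurphy q g (k + 1) + jucysMurphy q g k * g k := by
  rw [jucysMurphy_succ, mul_smul_comm, ← mul_assoc, ← mul_assoc, h.quadratic k hk]
  simp only [add_mul, smul_add, smul_mul_assoc, one_mul, inv_smul_smul₀ hq]
  rw [smul_comm]

theorem jucysMurphy_succ_mul_gen (h : IsHeckeSeq q n g) (hq : q ≠ 0) {k : ℕ} (hk : k + 1 < n) :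
    jucysMurphy q g (k + 1) * g k =
      (q - 1) • jucysMurphy q g (k + 1) + g k * jucysMurphy q g k := by
  rw [jucysMurphy_succ, smul_mul_assoc, mul_assoc, h.quadratic k hk]
  simp only [mul_add, smul_add, mul_smul_comm, mul_one, inv_smul_smul₀ hq]
  rw [smul_comm]

theorem commute_jmProd_of_le (h : IsHeckeSeq q n g) {c : F} {j a : ℕ} (hja : a ≤ j) :
    Commute (g j) (jmProd q g c a) :=
  commute_jmProd fun _ hk => h.commute_jucysMurphy_of_lt (by omega)

/-- The product is symmetric in L_j and L_{j+1}, and g_j commutes with L_j + L_{j+1} and with L_j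
L_{j+1}. The other factors commute with g_j individually. -/
theorem commute_jmProd_of_lt (h : IsHeckeSeq q n g) (hq : q ≠ 0) {c : F} {j a : ℕ} (ha : a ≤ n)
    (hja : j + 1 < a) : Commute (g j) (jmProd q g c a) := by
  induction a with
  | zero => omega
  | succ a ih =>
    rcases Nat.lt_or_ge (j + 1) a with hj | hj
    · exact (ih (by omega) hj).mul_right ((Commute.one_right _).sub_right
        ((h.commute_jucysMurphy_of_gt hj).smul_right _))
    · obtain rfl : a = j + 1 := by omega
      rw [jmProd_succ, jmProd_succ, mul_assoc]
      refine (h.commute_jmProd_of_le le_rfl).mul_right ?_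
      have h1 := h.gen_mul_jucysMurphy_succ hq (k := j) (by omega)
      have h2 := h.jucysMurphy_succ_mul_gen hq (k := j) (by omega)
      have h3 := (h.jucysMurphy_comm j (j + 1)).eq
      generalize jucysMurphy q g (j + 1) = x at h1 h2 h3 ⊢
      generalize jucysMurphy q g j = y at h1 h2 h3 ⊢
      have h4 : g j * y = x * g j - (q - 1) • x := by rw [h2]; abel
      have h5 : g j * (x + y) = (x + y) * g j := by rw [mul_add, add_mul, h1, h4]; abel
      have h6 : g j * (y * x) = y * x * g j := by
        rw [← mul_assoc, h4, sub_mul, mul_assoc, h1, mul_add, mul_smul_comm, smul_mul_assoc,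
          add_sub_cancel_left, ← mul_assoc, h3]
      have h7 : (1 - c • y) * (1 - c • x) = 1 - c • (x + y) + (c * c) • (y * x) := by
        simp only [mul_sub, sub_mul, mul_one, one_mul, smul_mul_smul_comm, smul_add]
        abel
      rw [h7]
      exact ((Commute.one_right _).sub_right (Commute.smul_right h5 _)).add_right
        (Commute.smul_right h6 _)

theorem descProd_smul_jucysMurphy (k l : ℕ) :
    descProd (conjOp q g) k l • jucysMurphy q g k = jucysMurphy q g (k + l) := by
  induction l with
  | zero => simp
  | succ l ih => rw [descProd_succ, mul_smul, ih, conjOp_smul]; rfl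

theorem conjOp_smul_one (h : IsHeckeSeq q n g) (hq : q ≠ 0) {k : ℕ} (hk : k + 1 < n) :
    conjOp q g k • (1 : A) = 1 + (1 - q⁻¹) • g k := by
  rw [conjOp_smul, mul_one, h.quadratic k hk, smul_add, smul_smul, smul_smul, inv_mul_cancel₀ hq,
    one_smul, add_comm, mul_sub, inv_mul_cancel₀ hq, mul_one]

theorem conjOp_smul_gen (h : IsHeckeSeq q n g) (k : ℕ) :
    conjOp q g (k + 1) • g k = conjOp q g k • g (k + 1) := by
  rw [conjOp_smul, conjOp_smul, h.braid]

/-- This is the passage from multiplicative to additive Jucys-Murphy elements: the trace term is a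
sum of scaled T_w over transpositions w moving the last point. At a = 0 it expresses L_{l+1} - 1 as
a multiple of a relative trace of g_l. -/
theorem descProd_smul_one (h : IsHeckeSeq q n g) (hq : q ≠ 0) (a l : ℕ) (hl : a + l + 1 < n) :
    descProd (conjOp q g) a (l + 1) • (1 : A) =
      1 + (1 - q⁻¹) • relTrace (fun k => conjOp q g (a + k)) l 1 • g (a + l) := by
  induction l with
  | zero => simp [descProd_succ, h.conjOp_smul_one hq hl]
  | succ l ih =>
    have hT := h.isTransferSeq hq
    have hc : Commute (conjOp q g (a + (l + 1))) (relTrace (fun k => conjOp q g (a + k)) l 1) :=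
      commute_relTrace fun k hk => hT.comm' _ _ (by omega)
    rw [descProd_succ, mul_smul, ih (by omega), smul_add, smul_comm _ (1 - q⁻¹), smul_smul, hc.eq,
      mul_smul, ← add_assoc, h.conjOp_smul_gen, h.conjOp_smul_one hq (by omega), relTrace_succ_one,
      add_smul, one_smul, mul_smul, smul_add, add_assoc]

/-- In the Pascal-type recursion, the descending product fixes the first a factors and moves L_a to
L_{a+b+1}. It also changes 1 into 1 plus a trace, and `relTrace_mul_relTrace` rewrites that error as
a trace from S_{a+b} × S_1. After summation over a + b = m the errors cancel against L_{m+1} - 1. -/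
theorem relTrace_smul_jmProd_succ (h : IsHeckeSeq q n g) (hq : q ≠ 0) (c : F) {a b : ℕ}
    (hab : a + b + 1 < n) :
    relTrace (conjOp q g) (a + 1) (b + 1) • jmProd q g c (a + 1) =
      relTrace (conjOp q g) (a + 1) b • jmProd q g c (a + 1) +
      relTrace (conjOp q g) a (b + 1) • jmProd q g c a * (1 - c • jucysMurphy q g (a + b + 1)) +
      (1 - q⁻¹) • relTrace (conjOp q g) (a + b) 1 •
        (relTrace (conjOp q g) a b • jmProd q g c a * g (a + b)) := by
  have hT := h.isTransferSeq hq
  have e1 : descProd (conjOp q g) a (b + 1) • jmProd q g c (a + 1) =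
      jmProd q g c a * (1 - c • jucysMurphy q g (a + b + 1)) + (1 - q⁻¹) •
        relTrace (fun k => conjOp q g (a + k)) b 1 • (jmProd q g c a * g (a + b)) := by
    rw [jmProd_succ, env_smul_mul_left (commute_descProd fun k hk _ =>
        commute_tmul_one_conjOp q (h.commute_jmProd_of_le hk).symm), smul_sub, smul_comm,
      descProd_smul_jucysMurphy, h.descProd_smul_one hq a b hab, env_smul_mul_left
        (commute_relTrace fun k _ => commute_tmul_one_conjOp q (h.commute_jmProd_of_le
          (Nat.le_add_right a k)).symm), ← mul_smul_comm, ← mul_add, ← add_assoc]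
    congr 1
    abel
  have e2 : relTrace (conjOp q g) a (b + 1) •
      (jmProd q g c a * (1 - c • jucysMurphy q g (a + b + 1))) =
      relTrace (conjOp q g) a (b + 1) • jmProd q g c a *
        (1 - c • jucysMurphy q g (a + b + 1)) :=
    env_smul_mul_right (commute_relTrace fun k hk => commute_one_tmul_conjOp q
      (((Commute.one_right _).sub_right
        ((h.commute_jucysMurphy_of_gt (by omega)).smul_right _)).symm)) _
  have e3 : relTrace (conjOp q g) a b • (jmProd q g c a * g (a + b)) =
      relTrace (conjOp q g) a b • jmProd q g c a * g (a + b) :=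
    env_smul_mul_right (commute_relTrace fun k hk => commute_one_tmul_conjOp q
      (h.comm' _ _ (by omega))) _
  rw [relTrace_succ_succ, add_smul, mul_smul, e1, smul_add, e2, smul_comm _ (1 - q⁻¹), smul_smul,
    hT.relTrace_mul_relTrace, mul_smul, e3, ← add_assoc]

open Finset in
/-- The relative traces of the products `(1 - c L_0) ⋯ (1 - c L_{a-1})` add up to `1`. -/
theorem sum_relTrace_smul_jmProd (h : IsHeckeSeq q n g) (hq : q ≠ 0) (c : F) : ∀ m ≤ n,
    ∑ ab ∈ antidiagonal m, c ^ ab.2 • relTrace (conjOp q g) ab.1 ab.2 • jmProd q g c ab.1 = 1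
  | 0, _ => by simp [jmProd]
  | 1, _ => by
    simp [Nat.antidiagonal_succ, jmProd, jucysMurphy]
  | m + 2, hm => by
    have h1 := h.sum_relTrace_smul_jmProd hq c (m + 1) (by omega)
    have h0 := h.sum_relTrace_smul_jmProd hq c m (by omega)
    have hx : jucysMurphy q g (m + 1) =
        1 + (1 - q⁻¹) • relTrace (conjOp q g) m 1 • g m := by
      have e := h.descProd_smul_one hq 0 m (by omega)
      have e' := descProd_smul_jucysMurphy (q := q) (g := g) 0 (m + 1)
      simp only [zero_add] at e e'
      rw [← e', ← e]
      rfl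
    have hs : ∀ ab ∈ antidiagonal m, c ^ (ab.2 + 1) • relTrace (conjOp q g) (ab.1 + 1) (ab.2 + 1) •
        jmProd q g c (ab.1 + 1) =
        c • c ^ ab.2 • relTrace (conjOp q g) (ab.1 + 1) ab.2 • jmProd q g c (ab.1 + 1) +
        (c ^ (ab.2 + 1) • relTrace (conjOp q g) ab.1 (ab.2 + 1) • jmProd q g c ab.1) *
          (1 - c • jucysMurphy q g (m + 1)) + (c * (1 - q⁻¹)) • relTrace (conjOp q g) m 1 •
            ((c ^ ab.2 • relTrace (conjOp q g) ab.1 ab.2 • jmProd q g c ab.1) * g m) := by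
      intro ab hab
      rw [HasAntidiagonal.mem_antidiagonal] at hab
      rw [h.relTrace_smul_jmProd_succ hq c (by omega), hab]
      generalize relTrace (conjOp q g) ab.1 ab.2 • jmProd q g c ab.1 = x
      generalize relTrace (conjOp q g) ab.1 (ab.2 + 1) • jmProd q g c ab.1 = y
      rw [smul_mul_assoc (c ^ ab.2) x, smul_comm _ (c ^ ab.2) (x * g m), smul_mul_assoc _ y]
      generalize relTrace (conjOp q g) (ab.1 + 1) ab.2 • jmProd q g c (ab.1 + 1) = u
      generalize relTrace (conjOp q g) m 1 • (x * g m) = v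
      module
    -- The identity for m + 1 is used twice: once without its term a = 0, which gives 1 - c^(m+1),
    -- and once without its term b = 0, which gives 1 minus the full product.
    have h1a := h1
    rw [Nat.sum_antidiagonal_succ, ← eq_sub_iff_add_eq'] at h1a
    rw [Nat.sum_antidiagonal_succ', ← eq_sub_iff_add_eq'] at h1
    rw [Nat.sum_antidiagonal_succ, Nat.sum_antidiagonal_succ', sum_congr rfl hs, sum_add_distrib,
      sum_add_distrib, ← smul_sum, ← smul_sum, ← smul_sum, ← sum_mul, ← sum_mul, h0, one_mul,
      h1a, h1, jmProd_succ q g c (m + 1)]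
    simp only [relTrace_zero_left, relTrace_zero_right, one_smul, pow_zero]
    rw [hx]
    generalize relTrace (conjOp q g) m 1 • g m = r
    generalize jmProd q g c (m + 1) = s
    simp only [jmProd, mul_sub, sub_mul, mul_add, mul_one, one_mul, mul_smul_comm, smul_sub,
      smul_add, smul_smul]
    module

end IsHeckeSeq

end HeckeSequence

/-! ### Eigenvalues of the Jucys-Murphy elements, and finite dimensionality. -/

section HeckeFinite

variable {F A : Type u} [Field F] [Ring A] [Algebra F A]

namespace IsHeckeSeq

variable {q : F} {n : ℕ} {g : ℕ → A}

/-- If `L_k ^ e - 1` is nilpotent then so is `L_{k+1} ^ e - 1`. -/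
theorem isNilpotent_jucysMurphy_pow_sub_one (h : IsHeckeSeq q n g) (hq : q ≠ 0) {e : ℕ}
    (he : q ^ e = 1) {k : ℕ} (hk : k < n) : IsNilpotent (jucysMurphy q g k ^ e - 1) := by
  induction k with
  | zero => simp [jucysMurphy]
  | succ k ih =>
    obtain ⟨N, hN⟩ := ih (by omega)
    have h1 := h.gen_mul_jucysMurphy_succ hq hk
    have h2 := h.jucysMurphy_succ_mul_gen hq hk
    have h3 : Commute (jucysMurphy q g (k + 1)) (jucysMurphy q g k) := h.jucysMurphy_comm _ _
    have hT := h.quadratic k hk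
    generalize jucysMurphy q g (k + 1) = x at h1 h2 h3 ⊢
    generalize jucysMurphy q g k = y at h1 h2 h3 hN
    generalize g k = t at h1 h2 hT
    have h3' := h3.eq
    -- φ is the intertwiner: it exchanges x = L_{k+1} and y = L_k, and its square is -(q x - y)(x -
    -- q y). Hence (x^e - 1)^N φ = φ (y^e - 1)^N = 0, and multiplying by φ gives a polynomial
    -- relation between x and y.
    obtain ⟨φ, hφ⟩ : ∃ φ, φ = t * (y - x) + (q - 1) • x := ⟨_, rfl⟩
    have hty : t * y = x * t - (q - 1) • x := by rw [h2]; abel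
    have hyt : y * t = t * x - (q - 1) • x := by rw [h1]; abel
    have e1 : SemiconjBy φ y x := by
      rw [SemiconjBy, hφ, mul_add, ← mul_assoc x, h2]
      simp only [add_mul, sub_mul, mul_sub, mul_smul_comm, smul_mul_assoc, mul_assoc, h3']
      abel
    have e2 : SemiconjBy φ x y := by
      rw [SemiconjBy, hφ, mul_add, ← mul_assoc y, hyt]
      simp only [add_mul, sub_mul, mul_sub, mul_smul_comm, smul_mul_assoc, mul_assoc, h3']
      abel
    have e3 : φ * t = q • (x - y) - (q - 1) • (t * x) + ((q - 1) * (q - 1)) • x := by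
      rw [hφ, add_mul, mul_assoc, sub_mul, hyt, smul_mul_assoc, h2]
      simp only [mul_add, mul_sub, mul_smul_comm, ← mul_assoc, hT, add_mul, smul_mul_assoc, one_mul]
      module
    have e4 : φ * φ = -((q • x - y) * (x - q • y)) := by
      have : φ * φ = φ * t * (y - x) + (q - 1) • (φ * x) := by
        conv_lhs => rw [hφ, mul_add, mul_smul_comm, ← mul_assoc, ← hφ]
      rw [this, e3, hφ]
      simp only [mul_sub, add_mul, sub_mul, mul_smul_comm, smul_mul_assoc, mul_assoc, h3', smul_sub,
        smul_add]
      module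
    have e5 : (x ^ e - 1) ^ N * φ = 0 := by
      have : SemiconjBy φ ((y ^ e - 1) ^ N) ((x ^ e - 1) ^ N) :=
        ((e1.pow_right e).sub_right (SemiconjBy.one_right φ)).pow_right N
      rw [← this.eq, hN, mul_zero]
    have e6 : (x ^ e - 1) ^ N * ((q • x - y) * (x - q • y)) = 0 := by
      rw [← neg_neg ((q • x - y) * _), ← e4, mul_neg, ← mul_assoc, e5, zero_mul, neg_zero]
    -- As q^e = 1, both q x - y and x - q y divide x^e - y^e, so their product divides its square.
    have e7 : (x ^ e - 1) ^ N * ((x ^ e - y ^ e) * (x ^ e - y ^ e)) = 0 := by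
      have c1 : Commute (q • x) y := h3.smul_left q
      have c2 : Commute x (q • y) := h3.smul_right q
      have d1 := c1.mul_geom_sum₂ e
      have d2 := c2.mul_geom_sum₂ e
      rw [smul_pow, he, one_smul] at d1 d2
      have c3 : Commute (∑ i ∈ Finset.range e, (q • x) ^ i * y ^ (e - 1 - i)) (x - q • y) := by
        refine Commute.sum_left _ _ _ fun i _ => ?_
        refine Commute.mul_left (Commute.pow_left ?_ _) (Commute.pow_left ?_ _)
        · exact ((Commute.refl x).sub_right c2).smul_left q
        · exact h3.symm.sub_right ((Commute.refl y).smul_right q)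
      rw [← d1]
      nth_rw 2 [d1]
      rw [← d2, mul_assoc (q • x - y), ← mul_assoc _ (x - q • y), c3.eq, mul_assoc (x - q • y),
        ← mul_assoc (q • x - y), ← mul_assoc, e6, zero_mul]
    have cXY : Commute (x ^ e - 1) (y ^ e - 1) :=
      ((h3.pow_pow e e).sub_right (Commute.one_right _)).sub_left (Commute.one_left _)
    have hD : x ^ e - y ^ e = (x ^ e - 1) - (y ^ e - 1) := by abel
    rw [hD] at e7
    have hYn : IsNilpotent (y ^ e - 1) := ⟨N, hN⟩
    generalize x ^ e - 1 = X at e7 cXY ⊢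
    generalize y ^ e - 1 = Y at e7 cXY hYn
    have cXD : Commute X (X - Y) := (Commute.refl X).sub_right cXY
    have n1 : IsNilpotent (X * (X - Y)) := by
      refine ⟨N + 2, ?_⟩
      have : (X * (X - Y)) ^ (N + 2) = X ^ 2 * (X ^ N * ((X - Y) * (X - Y))) * (X - Y) ^ N := by
        rw [cXD.mul_pow, add_comm N 2, pow_add, pow_add, pow_two (X - Y)]
        simp only [mul_assoc]
      rw [this, e7, mul_zero, zero_mul]
    have n2 : IsNilpotent (X * Y) := cXY.isNilpotent_mul_left hYn
    have n3 : IsNilpotent (X ^ 2) := by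
      have : X ^ 2 = X * (X - Y) + X * Y := by rw [mul_sub, sub_add_cancel, pow_two]
      rw [this]
      refine Commute.isNilpotent_add ?_ n1 n2
      exact (((Commute.refl X).mul_right cXY).mul_left (cXD.symm.mul_right
        ((cXY.symm.sub_right (Commute.refl Y)).symm)))
    exact n3.of_pow

/-- L_1 = 1 + (1 - q⁻¹) T_1, and the roots q and -1 of the quadratic relation for T_1 become q and
q⁻¹. -/
theorem jucysMurphy_one_quadratic (h : IsHeckeSeq q n g) (hq : q ≠ 0) (hn : 1 < n) :
    (jucysMurphy q g 1 - q • 1) * (jucysMurphy q g 1 - q⁻¹ • 1) = 0 := by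
  have h2 := h.quadratic 0 (by omega)
  have : jucysMurphy q g 1 = (1 - q⁻¹) • g 0 + 1 := by
    rw [jucysMurphy_succ, jucysMurphy, mul_one, h2, smul_add, smul_smul, smul_smul,
      inv_mul_cancel₀ hq, one_smul, mul_sub, inv_mul_cancel₀ hq, mul_one]
  rw [this]
  simp only [mul_add, add_mul, sub_mul, mul_sub, smul_mul_smul_comm, h2, mul_one, smul_add,
    one_mul]
  match_scalars <;> field_simp <;> ring

/-- A finitely generated subspace that contains `1` and is stable under the first generators. -/
theorem exists_fg_stable (h : IsHeckeSeq q n g) : ∀ k < n, ∃ W : Submodule F A,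
    W.FG ∧ 1 ∈ W ∧ ∀ x ∈ W, ∀ j < k, x * g j ∈ W
  | 0, _ => ⟨Submodule.span F {1}, Submodule.fg_span_singleton 1,
      Submodule.mem_span_singleton_self 1, fun _ _ _ hj => absurd hj (Nat.not_lt_zero _)⟩
  | k + 1, hk => by
    obtain ⟨W, hW, h1, hg⟩ := h.exists_fg_stable k (by omega)
    -- The products g_k ⋯ g_a for a ≤ k + 1, the empty one included, correspond to coset
    -- representatives of S_{k+1} in S_{k+2}.
    let y : ℕ → A := fun a => descProd g a (k + 1 - a)
    have hy : ∀ a ≤ k + 1, ∀ x ∈ W, x * y a ∈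
        ⨆ a ∈ Finset.range (k + 2), W.map (LinearMap.mulRight F (y a)) := fun a ha x hx =>
      Submodule.mem_iSup_of_mem a (Submodule.mem_iSup_of_mem (Finset.mem_range.2 (by omega))
        ⟨x, hx, rfl⟩)
    refine ⟨⨆ a ∈ Finset.range (k + 2), W.map (LinearMap.mulRight F (y a)),
      Submodule.fg_biSup _ _ fun a _ => hW.map _, ?_, fun x hx j hj => ?_⟩
    · have := hy (k + 1) le_rfl 1 h1
      simpa [y] using this
    · have key : ∀ a ≤ k + 1, ∀ x ∈ W, x * y a * g j ∈
          ⨆ a ∈ Finset.range (k + 2), W.map (LinearMap.mulRight F (y a)) := by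
        intro a ha x hx
        rcases lt_trichotomy (j + 1) a with hja | hja | hja
        · have : Commute (g j) (y a) := commute_descProd fun i hi _ => h.comm' _ _ (by omega)
          rw [mul_assoc, ← this.eq, ← mul_assoc]
          exact hy a ha _ (hg x hx j (by omega))
        · obtain rfl := hja
          have : y (j + 1) * g j = y j := by
            simp only [y]
            rw [← descProd_succ_right, show k + 1 - (j + 1) + 1 = k + 1 - j by omega]
          rw [mul_assoc, this]
          exact hy j (by omega) x hx
        · rcases Nat.lt_or_ge a j with haj | haj
          · obtain ⟨i, rfl⟩ : ∃ i, j = i + 1 := ⟨j - 1, by omega⟩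
            have : g i * y a = y a * g (i + 1) := mul_descProd_of_up (fun i j => h.comm' i j)
              (fun k => by rw [← mul_assoc, h.braid]) (by omega) (by omega)
            rw [mul_assoc, ← this, ← mul_assoc]
            exact hy a ha _ (hg x hx i (by omega))
          · obtain rfl : a = j := by omega
            have e1 : y a = y (a + 1) * g a := by
              simp only [y]
              rw [← descProd_succ_right, show k + 1 - (a + 1) + 1 = k + 1 - a by omega]
            have e2 : x * y a * g a = (q - 1) • (x * y a) + q • (x * y (a + 1)) := by
              conv_lhs => rw [e1]
              rw [mul_assoc, mul_assoc, h.quadratic a (by omega), mul_add, mul_add, mul_smul_comm,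
                mul_smul_comm, mul_smul_comm, mul_smul_comm, mul_one, ← e1]
            rw [e2]
            exact add_mem (Submodule.smul_mem _ _ (hy a ha x hx))
              (Submodule.smul_mem _ _ (hy (a + 1) (by omega) x hx))
      induction hx using Submodule.iSup_induction' with
      | zero => rw [zero_mul]; exact zero_mem _
      | add x y _ _ hx hy => rw [add_mul]; exact add_mem hx hy
      | mem a x hx =>
        by_cases ha : a ∈ Finset.range (k + 2)
        · simp only [ha, iSup_pos] at hx
          obtain ⟨w, hw, rfl⟩ := hx
          exact key a (by have := Finset.mem_range.1 ha; omega) w hw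
        · simp only [ha, iSup_false, Submodule.mem_bot] at hx
          rw [hx, zero_mul]
          exact zero_mem _

end IsHeckeSeq

end HeckeFinite

/-! ## The Hecke algebra -/

namespace HeckeAlgebra

variable {F A : Type u} [Field F] [Ring A] [Algebra F A]

/-- The generators of the Hecke algebra, continued by `0`. -/
def genSeq (q : F) (n k : ℕ) : HeckeAlgebra F q n :=
  if h : k < n - 1 then gen q ⟨k, h⟩ else 0

variable {q : F} {n : ℕ}

theorem genSeq_of_lt {k : ℕ} (h : k < n - 1) : genSeq q n k = gen q ⟨k, h⟩ := dif_pos h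

theorem isHeckeSeq_genSeq (q : F) (n : ℕ) : IsHeckeSeq q n (genSeq q n) where
  comm i j hij := by
    by_cases hj : j < n - 1
    · rw [genSeq_of_lt hj, genSeq_of_lt (by omega : i < n - 1)]
      have := RingQuot.mkAlgHom_rel F
        (HeckeRel.comm (F := F) (q := q) (n := n) ⟨i, by omega⟩ ⟨j, hj⟩ (by simp; omega))
      simp only [map_mul] at this
      exact this
    · rw [show genSeq q n j = 0 from dif_neg hj]
      exact Commute.zero_right _
  braid k := by
    by_cases hj : k + 1 < n - 1
    · rw [genSeq_of_lt hj, genSeq_of_lt (by omega : k < n - 1)]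
      have := RingQuot.mkAlgHom_rel F
        (HeckeRel.braid (F := F) (q := q) (n := n) ⟨k, by omega⟩ ⟨k + 1, hj⟩ rfl)
      simp only [map_mul] at this
      exact this
    · rw [show genSeq q n (k + 1) = 0 from dif_neg hj]
      simp
  quadratic k hk := by
    rw [genSeq_of_lt (by omega)]
    have := RingQuot.mkAlgHom_rel F
      (HeckeRel.quadratic (F := F) (q := q) (n := n) ⟨k, by omega⟩)
    simp only [map_mul, map_sub, map_add, map_one, map_zero, AlgHom.commutes] at this
    change (gen q _ - _) * (gen q _ + 1) = 0 at this
    rw [Algebra.algebraMap_eq_smul_one, sub_mul, mul_add, mul_one, smul_mul_assoc, one_mul] at this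
    rw [eq_comm, ← sub_eq_zero, ← neg_eq_zero, ← this]
    module
  eq_zero k hk := dif_neg (by omega)

/-- The homomorphism from the Hecke algebra determined by a Hecke sequence. -/
def lift {m : ℕ} {g : ℕ → A} (h : IsHeckeSeq q m g) (i n : ℕ) (hin : i + n ≤ m) :
    HeckeAlgebra F q n →ₐ[F] A :=
  RingQuot.liftAlgHom F ⟨FreeAlgebra.lift F fun k : Fin (n - 1) => g (i + k), by
    intro x y hxy
    induction hxy with
    | quadratic k =>
      have := h.quadratic (i + k) (by omega)
      simp only [map_mul, map_sub, map_add, map_one, map_zero, AlgHom.commutes,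
        FreeAlgebra.lift_ι_apply]
      simp only [Algebra.algebraMap_eq_smul_one, sub_mul, mul_add, mul_one, this, smul_mul_assoc,
        one_mul]
      module
    | comm k l hkl =>
      simp only [map_mul, FreeAlgebra.lift_ι_apply]
      exact h.comm _ _ (by omega)
    | braid k l hkl =>
      simp only [map_mul, FreeAlgebra.lift_ι_apply, ← hkl]
      exact h.braid _⟩

theorem lift_genSeq {m : ℕ} {g : ℕ → A} (h : IsHeckeSeq q m g) (i n : ℕ) (hin : i + n ≤ m) {k : ℕ}
    (hk : k + 1 < n) : lift h i n hin (genSeq q n k) = g (i + k) := by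
  rw [genSeq_of_lt (by omega), gen, lift, RingQuot.liftAlgHom_mkAlgHom_apply,
    FreeAlgebra.lift_ι_apply]

theorem adjoin_genSeq (q : F) (n : ℕ) :
    Algebra.adjoin F (genSeq q n '' {k | k + 1 < n}) = ⊤ := by
  rw [eq_top_iff]
  rintro x -
  obtain ⟨y, rfl⟩ := RingQuot.mkAlgHom_surjective F (HeckeRel F q n) x
  induction y using FreeAlgebra.induction with
  | grade0 r => rw [AlgHom.commutes]; exact Subalgebra.algebraMap_mem _ r
  | grade1 i =>
    refine Algebra.subset_adjoin ⟨i, ?_, ?_⟩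
    · have := i.2
      exact (show (i : ℕ) + 1 < n by omega)
    · rw [genSeq_of_lt i.2]; rfl
  | mul a b ha hb => rw [map_mul]; exact mul_mem ha hb
  | add a b ha hb => rw [map_add]; exact add_mem ha hb

theorem induction_genSeq {p : HeckeAlgebra F q n → Prop} (hgen : ∀ k, k + 1 < n → p (genSeq q n k))
    (halg : ∀ r : F, p (algebraMap F _ r)) (hadd : ∀ x y, p x → p y → p (x + y))
    (hmul : ∀ x y, p x → p y → p (x * y)) (x : HeckeAlgebra F q n) : p x := by
  have hx : x ∈ Algebra.adjoin F (genSeq q n '' {k | k + 1 < n}) := by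
    rw [adjoin_genSeq]; trivial
  induction hx using Algebra.adjoin_induction with
  | mem x hx => obtain ⟨k, hk, rfl⟩ := hx; exact hgen k hk
  | algebraMap r => exact halg r
  | add x y _ _ hx hy => exact hadd x y hx hy
  | mul x y _ _ hx hy => exact hmul x y hx hy

theorem commute_of_commute_genSeq {x : HeckeAlgebra F q n}
    (hx : ∀ k, k + 1 < n → Commute x (genSeq q n k)) (y : HeckeAlgebra F q n) : Commute x y :=
  induction_genSeq (p := Commute x) hx (fun r => Algebra.commutes' r x |>.symm)
    (fun _ _ => Commute.add_right) (fun _ _ => Commute.mul_right) y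

/-- A right-stable subspace containing 1 is everything. Finiteness makes the centre Artinian, and
makes the commutative algebra generated by the centre and the Jucys-Murphy elements integral over
the centre. -/
instance finite (q : F) (n : ℕ) : Module.Finite F (HeckeAlgebra F q n) := by
  have : ∃ W : Submodule F (HeckeAlgebra F q n), W.FG ∧ 1 ∈ W ∧ ∀ x ∈ W, ∀ j, j + 1 < n →
      x * genSeq q n j ∈ W := by
    rcases n with _ | n
    · exact ⟨Submodule.span F {1}, Submodule.fg_span_singleton 1,
        Submodule.mem_span_singleton_self 1, fun _ _ _ hj => absurd hj (Nat.not_lt_zero _)⟩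
    · obtain ⟨W, h1, h2, h3⟩ := (isHeckeSeq_genSeq q (n + 1)).exists_fg_stable n (by omega)
      exact ⟨W, h1, h2, fun x hx j hj => h3 x hx j (by omega)⟩
  obtain ⟨W, hW, h1, hg⟩ := this
  refine ⟨?_⟩
  convert hW
  rw [eq_comm, eq_top_iff]
  rintro y -
  have key : ∀ x ∈ W, x * y ∈ W := by
    refine induction_genSeq (p := fun y => ∀ x ∈ W, x * y ∈ W) (fun k hk x hx => hg x hx k hk)
      (fun r x hx => ?_) (fun y z hy hz x hx => ?_) (fun y z hy hz x hx => ?_) y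
    · rw [← Algebra.commutes, ← Algebra.smul_def]; exact W.smul_mem r hx
    · rw [mul_add]; exact add_mem (hy x hx) (hz x hx)
    · rw [← mul_assoc]; exact hz _ (hy x hx)
  simpa using key 1 h1

end HeckeAlgebra

/-! ## The ideal of relative traces in characteristic zero -/

section Annihilation

variable {F A : Type u} [Field F] [Ring A] [Algebra F A]

theorem smul_eq_zero_of_mem_span_commOp {V : Type*} [AddCommGroup V] [Module (Env F A) V]
    {g : ℕ → A} {S : Set ℕ} {w : Env F A} (hw : w ∈ Ideal.span (commOp F g '' S)) {v : V}
    (hv : ∀ j ∈ S, commOp F g j • v = 0) : w • v = 0 := by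
  induction hw using Submodule.span_induction with
  | mem x hx => obtain ⟨j, hj, rfl⟩ := hx; exact hv j hj
  | zero => exact zero_smul (Env F A) v
  | add x y _ _ hx hy => rw [add_smul, hx, hy, add_zero]
  | smul c x _ hx => rw [smul_eq_mul, mul_smul, hx, smul_zero c]

theorem commOp_smul_eq_zero_iff {g : ℕ → A} {k : ℕ} {x : A} :
    commOp F g k • x = 0 ↔ Commute x (g k) := by
  rw [commOp_smul, sub_eq_zero, eq_comm]; rfl

theorem IsHeckeSeq.commute_relTrace_smul {q : F} {n : ℕ} {g : ℕ → A} (h : IsHeckeSeq q n g)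
    (hq : q ≠ 0) {a b : ℕ} {x : A} (hx : ∀ k, k + 1 < a + b → k + 1 ≠ a → Commute x (g k)) {k : ℕ}
    (hk : k + 1 < a + b) : Commute (relTrace (conjOp q g) a b • x) (g k) := by
  rw [← commOp_smul_eq_zero_iff (F := F), smul_smul]
  exact smul_eq_zero_of_mem_span_commOp ((h.isTransferSeq hq).delta_mul_relTrace hk)
    fun j hj => commOp_smul_eq_zero_iff.2 (hx j hj.1 hj.2)

end Annihilation

/-! ### Roots of unity forced by the trace identity. -/

section Roots

open Polynomial in
/-- A family whose reversed characteristic polynomial is `1 - X ^ n` enumerates the `n`-th roots of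
unity. -/
theorem prod_X_sub_C_eq_X_pow_sub_one {F κ : Type*} [Field F] [Infinite F] [Field κ] [Algebra F κ]
    {n : ℕ} {c : Fin n → κ} (h : ∀ t : F, ∏ i, (1 - algebraMap F κ t * c i) =
      1 - algebraMap F κ t ^ n) : ∏ i, (X - C (c i)) = (X ^ n - 1 : κ[X]) := by
  -- Both sides are compared at the infinitely many nonzero t in F, with the hypothesis taken at t⁻¹
  -- since it concerns the reversed polynomial.
  refine Polynomial.eq_of_infinite_eval_eq _ _ (Set.Infinite.mono (s := algebraMap F κ '' {0}ᶜ) ?_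
    (((Set.finite_singleton (0 : F)).infinite_compl).image (algebraMap F κ).injective.injOn))
  rintro _ ⟨t, ht, rfl⟩
  have ht' : algebraMap F κ t ≠ 0 := by simpa using ht
  have h1 := h t⁻¹
  rw [map_inv₀] at h1
  simp only [Set.mem_ofPred_eq, eval_prod, eval_sub, eval_X, eval_C, eval_pow, eval_one]
  have h2 : ∀ i, algebraMap F κ t - c i = algebraMap F κ t * (1 - (algebraMap F κ t)⁻¹ * c i) :=
    fun i => by field_simp
  rw [Finset.prod_congr rfl fun i _ => h2 i, Finset.prod_mul_distrib, h1, Finset.prod_const,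
    Finset.card_univ, Fintype.card_fin, mul_sub, ← mul_pow, mul_inv_cancel₀ ht', one_pow, mul_one]

open Polynomial in
-- The c_i are the n-th roots of unity, distinct in characteristic 0. Being e-th roots of unity as
-- well, they number at most e. As c_1 is q or q⁻¹ and is an n-th root of unity, e divides n.
theorem eq_of_prod_one_sub_eq {F κ : Type*} [Field F] [CharZero F] [Field κ] [Algebra F κ]
    {q : F} {e n : ℕ} (hq : IsPrimitiveRoot q e) (he : 0 < e) (hn : 1 < n) {c : ℕ → κ}
    (h : ∀ t : F, ∏ i ∈ Finset.range n, (1 - algebraMap F κ t * c i) = 1 - algebraMap F κ t ^ n)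
    (hc : ∀ i < n, c i ^ e = 1)
    (hc1 : (c 1 - algebraMap F κ q) * (c 1 - algebraMap F κ q⁻¹) = 0) : n = e := by
  have hP := prod_X_sub_C_eq_X_pow_sub_one (F := F) (c := fun i : Fin n => c i) fun t => by
    rw [← h t, Finset.prod_range]
  have hinj : Function.Injective fun i : Fin n => c i := by
    rw [← separable_prod_X_sub_C_iff, hP, X_pow_sub_one_separable_iff]
    have : ((n : F) : F) ≠ 0 := Nat.cast_ne_zero.2 (by omega)
    simpa using (map_ne_zero (algebraMap F κ)).2 this
  have hle : n ≤ e := by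
    classical
    have h1 : (Finset.univ.image fun i : Fin n => c i) ⊆ nthRootsFinset e (1 : κ) := by
      intro x hx
      obtain ⟨i, -, rfl⟩ := Finset.mem_image.1 hx
      exact (mem_nthRootsFinset he 1).2 (hc i i.2)
    have h2 := Finset.card_le_card h1
    rw [Finset.card_image_of_injective _ hinj, Finset.card_univ, Fintype.card_fin] at h2
    refine h2.trans ?_
    rw [nthRootsFinset]
    exact (Multiset.toFinset_card_le _).trans (card_nthRoots e 1)
  have hroot : c 1 ^ n = 1 := by
    have h1 := congr_arg (eval (c 1)) hP
    rw [eval_prod, Finset.prod_eq_zero (Finset.mem_univ (⟨1, hn⟩ : Fin n)) (by simp)] at h1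
    simp only [eval_sub, eval_pow, eval_X, eval_one] at h1
    exact (sub_eq_zero.1 h1.symm)
  have hqn : q ^ n = 1 := by
    refine (algebraMap F κ).injective ?_
    rw [map_pow, map_one]
    rcases mul_eq_zero.1 hc1 with h1 | h1
    · rw [← sub_eq_zero.1 h1, hroot]
    · rw [sub_eq_zero.1 h1, map_inv₀, inv_pow, inv_eq_one] at hroot
      exact hroot
  exact le_antisymm hle (Nat.le_of_dvd (by omega) ((hq.pow_eq_one_iff_dvd n).1 hqn))

end Roots

namespace HeckeAlgebra

variable {F : Type u} [Field F] {q : F} {n : ℕ}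

theorem relTrace_smul_mem_center (hq : q ≠ 0) {a : ℕ} (ha : a ≤ n) {x : HeckeAlgebra F q n}
    (hx : ∀ k, k + 1 < n → k + 1 ≠ a → Commute x (genSeq q n k)) :
    relTrace (conjOp q (genSeq q n)) a (n - a) • x ∈
      Subalgebra.center F (HeckeAlgebra F q n) := by
  rw [Subalgebra.mem_center_iff]
  refine fun b => (commute_of_commute_genSeq (fun k hk => ?_) b).symm.eq
  exact (isHeckeSeq_genSeq q n).commute_relTrace_smul hq (fun k hk => hx k (by omega)) (by omega)

variable (q n) in
/-- The ideal of the center generated by the relative traces from the maximal parabolic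
subalgebras. -/
def traceIdeal : Ideal (Subalgebra.center F (HeckeAlgebra F q n)) :=
  Ideal.span {z | ∃ a x, 0 < a ∧ a < n ∧ (∀ k, k + 1 < n → k + 1 ≠ a → Commute x (genSeq q n k)) ∧
    (z : HeckeAlgebra F q n) = relTrace (conjOp q (genSeq q n)) a (n - a) • x}

open Finset in
-- In the identity of `sum_relTrace_smul_jmProd` for n, the extreme terms are c^n and the full
-- product. All the others are relative traces from proper maximal parabolics.
theorem exists_mem_traceIdeal (hq : q ≠ 0) (hn : 1 < n) (c : F) : ∃ z ∈ traceIdeal q n,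
    (z : HeckeAlgebra F q n) = 1 - c ^ n • 1 - jmProd q (genSeq q n) c n := by
  obtain ⟨m, rfl⟩ : ∃ m, n = m + 2 := ⟨n - 2, by omega⟩
  have hg := isHeckeSeq_genSeq q (m + 2)
  have h1 := hg.sum_relTrace_smul_jmProd hq c (m + 2) le_rfl
  rw [Nat.sum_antidiagonal_succ, Nat.sum_antidiagonal_succ'] at h1
  simp only [relTrace_zero_left, relTrace_zero_right, one_smul, pow_zero] at h1
  have hx : ∀ a ≤ m, ∀ k, k + 1 < m + 2 → k + 1 ≠ a + 1 →
      Commute (jmProd q (genSeq q (m + 2)) c (a + 1)) (genSeq q (m + 2) k) := by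
    intro a ha k hk hka
    rcases Nat.lt_or_ge (k + 1) (a + 1) with h | h
    · exact (hg.commute_jmProd_of_lt hq (by omega) h).symm
    · exact (hg.commute_jmProd_of_le (by omega)).symm
  let z : ℕ → Subalgebra.center F (HeckeAlgebra F q (m + 2)) := fun a =>
    if ha : a ≤ m then ⟨_, relTrace_smul_mem_center hq (by omega) (hx a ha)⟩ else 0
  have hz : ∀ a (_ : a ≤ m), (z a : HeckeAlgebra F q (m + 2)) = relTrace
      (conjOp q (genSeq q (m + 2))) (a + 1) (m + 2 - (a + 1)) •
        jmProd q (genSeq q (m + 2)) c (a + 1) := fun a ha => by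
    simp only [z, dif_pos ha]
  refine ⟨∑ ab ∈ antidiagonal m, c ^ (ab.2 + 1) • z ab.1, Ideal.sum_mem _ fun ab hab => ?_, ?_⟩
  · have hab' : ab.1 ≤ m := by rw [HasAntidiagonal.mem_antidiagonal] at hab; omega
    rw [Algebra.smul_def]
    exact Ideal.mul_mem_left _ _ (Ideal.subset_span
      ⟨ab.1 + 1, _, by omega, by omega, hx _ hab', hz _ hab'⟩)
  · rw [sub_sub, eq_sub_iff_add_eq']
    refine Eq.trans ?_ h1
    rw [← add_assoc]
    refine congrArg₂ (· + ·) rfl ?_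
    simp only [AddSubmonoidClass.coe_finsetSum, SetLike.val_smul]
    refine sum_congr rfl fun ab hab => ?_
    rw [HasAntidiagonal.mem_antidiagonal] at hab
    rw [hz _ (by omega), show m + 2 - (ab.1 + 1) = ab.2 + 1 by omega]

/-- If the ideal were proper, a maximal ideal containing it would give a common specialisation of
the Jucys-Murphy elements in a field, and `eq_of_prod_one_sub_eq` would force n = e. -/
theorem traceIdeal_eq_top [CharZero F] {e : ℕ} (he : 1 < e) (hq : IsPrimitiveRoot q e)
    (hn : 1 < n) (hne : n ≠ e) : traceIdeal q n = ⊤ := by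
  have hq0 : q ≠ 0 := hq.ne_zero (by omega)
  have hg := isHeckeSeq_genSeq q n
  by_contra hJ
  obtain ⟨m, hm, hJm⟩ := Ideal.exists_le_maximal _ hJ
  let s : Set (HeckeAlgebra F q n) := Set.range (jucysMurphy q (genSeq q n)) ∪
    Subalgebra.center F (HeckeAlgebra F q n)
  have hs : ∀ a ∈ s, ∀ b ∈ s, a * b = b * a := by
    rintro a (⟨i, rfl⟩ | ha) b (⟨j, rfl⟩ | hb)
    · exact (hg.jucysMurphy_comm i j).eq
    · exact Subalgebra.mem_center_iff.1 hb _
    · exact (Subalgebra.mem_center_iff.1 ha _).symm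
    · exact (Subalgebra.mem_center_iff.1 ha _).symm
  have hcomm := Algebra.isMulCommutative_adjoin F hs
  let : CommRing (Algebra.adjoin F s) :=
    { (Algebra.adjoin F s).toRing with mul_comm := hcomm.is_comm.comm }
  let f : Subalgebra.center F (HeckeAlgebra F q n) →ₐ[F] Algebra.adjoin F s :=
    Subalgebra.inclusion fun z hz => Algebra.subset_adjoin (Or.inr hz)
  let : Algebra (Subalgebra.center F (HeckeAlgebra F q n)) (Algebra.adjoin F s) :=
    f.toRingHom.toAlgebra' fun _ _ => mul_comm _ _
  have : IsScalarTower F (Subalgebra.center F (HeckeAlgebra F q n)) (Algebra.adjoin F s) :=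
    IsScalarTower.of_algebraMap_eq fun x => (f.commutes x).symm
  have : Module.Finite F (Algebra.adjoin F s) := inferInstance
  have : Module.Finite (Subalgebra.center F (HeckeAlgebra F q n)) (Algebra.adjoin F s) :=
    Module.Finite.of_restrictScalars_finite F _ _
  have hinj : Function.Injective (algebraMap (Subalgebra.center F (HeckeAlgebra F q n))
    (Algebra.adjoin F s)) := Subalgebra.inclusion_injective _
  -- The Jucys-Murphy elements need not be central, so the maximal ideal is lifted to the larger
  -- commutative algebra, where they have residues.
  obtain ⟨P, hP, hPm⟩ := Ideal.exists_ideal_over_maximal_of_isIntegral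
    (R := Subalgebra.center F (HeckeAlgebra F q n)) (S := Algebra.adjoin F s) m
    (by rw [(RingHom.injective_iff_ker_eq_bot _).1 hinj]; exact bot_le)
  let := Ideal.Quotient.field P
  let L : ℕ → Algebra.adjoin F s := fun i =>
    ⟨jucysMurphy q (genSeq q n) i, Algebra.subset_adjoin (Or.inl ⟨i, rfl⟩)⟩
  have hL : ∀ (c : F) (a : ℕ), ((∏ i ∈ Finset.range a, (1 - c • L i) : Algebra.adjoin F s) :
      HeckeAlgebra F q n) = jmProd q (genSeq q n) c a := by
    intro c a
    induction a with
    | zero => rfl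
    | succ a ih => rw [Finset.prod_range_succ, jmProd_succ, ← ih]; rfl
  have halg : ∀ c : F, algebraMap F (Algebra.adjoin F s ⧸ P) c =
      Ideal.Quotient.mk P (algebraMap F _ c) := fun _ => rfl
  refine hne (eq_of_prod_one_sub_eq (κ := Algebra.adjoin F s ⧸ P) hq (by omega) hn
    (c := fun i => Ideal.Quotient.mk P (L i)) (fun t => ?_) (fun i hi => ?_) ?_)
  · obtain ⟨z, hz, hz'⟩ := exists_mem_traceIdeal (q := q) hq0 hn t
    have hzP : f z ∈ P := by
      have := hJm hz
      rwa [← hPm] at this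
    have hfz : f z = 1 - (algebraMap F _ t) ^ n - ∏ i ∈ Finset.range n, (1 - t • L i) := by
      apply Subtype.ext
      rw [AddSubgroupClass.coe_sub, hL, AddSubgroupClass.coe_sub, ← map_pow]
      refine hz'.trans ?_
      rw [← Algebra.algebraMap_eq_smul_one]
      rfl
    rw [hfz, ← Ideal.Quotient.eq_zero_iff_mem, map_sub, sub_eq_zero] at hzP
    rw [map_sub, map_one, map_pow, map_prod] at hzP
    rw [halg, hzP]
    refine Finset.prod_congr rfl fun i _ => ?_
    rw [map_sub, map_one, Algebra.smul_def, map_mul]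
  · have h1 : IsNilpotent (L i ^ e - 1) := by
      obtain ⟨N, hN⟩ := hg.isNilpotent_jucysMurphy_pow_sub_one hq0 hq.pow_eq_one hi
      exact ⟨N, Subtype.ext hN⟩
    have h2 := (h1.map (Ideal.Quotient.mk P)).eq_zero
    rw [map_sub, map_pow, map_one, sub_eq_zero] at h2
    exact h2
  · have h1 : (L 1 - algebraMap F _ q) * (L 1 - algebraMap F _ q⁻¹) = 0 := by
      apply Subtype.ext
      have := hg.jucysMurphy_one_quadratic hq0 hn
      rw [← Algebra.algebraMap_eq_smul_one, ← Algebra.algebraMap_eq_smul_one] at this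
      exact this
    rw [halg, halg, ← map_sub, ← map_sub, ← map_mul, h1, map_zero]

end HeckeAlgebra

/-! ## Transfer between parabolic subgroups -/

section Transferable

variable {F A : Type u} [Field F] [Ring A] [Algebra F A]

variable (F) in
/-- There is an operator on bimodules that sends elements commuting with the `g k`, `k ∈ S`, to
elements commuting with the `g k`, `k ∈ S'`, and that fixes `1`. -/
def IsTransferable (g : ℕ → A) (S' S : Set ℕ) : Prop :=
  ∃ w : Env F A, (∀ j ∈ S', commOp F g j * w ∈ Ideal.span (commOp F g '' S)) ∧ w • (1 : A) = 1

theorem mul_mem_span_commOp {g : ℕ → A} {S S' : Set ℕ} {w x : Env F A}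
    (hw : ∀ j ∈ S', commOp F g j * w ∈ Ideal.span (commOp F g '' S))
    (hx : x ∈ Ideal.span (commOp F g '' S')) : x * w ∈ Ideal.span (commOp F g '' S) := by
  induction hx using Submodule.span_induction with
  | mem x hx => obtain ⟨j, hj, rfl⟩ := hx; exact hw j hj
  | zero => rw [zero_mul]; exact zero_mem _
  | add x y _ _ hx hy => rw [add_mul]; exact add_mem hx hy
  | smul c x _ hx => rw [smul_eq_mul, mul_assoc]; exact Ideal.mul_mem_left _ _ hx

namespace IsTransferable

variable {g : ℕ → A} {S₁ S₂ S₃ : Set ℕ}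

theorem of_subset (h : S₁ ⊆ S₂) : IsTransferable F g S₁ S₂ :=
  ⟨1, fun j hj => by rw [mul_one]; exact Ideal.subset_span ⟨j, h hj, rfl⟩, one_smul _ _⟩

theorem trans (h₁ : IsTransferable F g S₁ S₂) (h₂ : IsTransferable F g S₂ S₃) :
    IsTransferable F g S₁ S₃ := by
  obtain ⟨w, hw, hw1⟩ := h₁
  obtain ⟨w', hw', hw1'⟩ := h₂
  refine ⟨w * w', fun j hj => ?_, by rw [mul_smul, hw1', hw1]⟩
  rw [← mul_assoc]
  exact mul_mem_span_commOp hw' (hw j hj)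

/-- The operator m ↦ x m x⁻¹ fixes 1 and intertwines the commutators with g_j and with g_k. -/
theorem of_conj {x y : A} (hxy : x * y = 1) (hyx : y * x = 1)
    (h : ∀ j ∈ S₁, ∃ k ∈ S₂, g j * x = x * g k) : IsTransferable F g S₁ S₂ := by
  refine ⟨x ⊗ₜ[F] MulOpposite.op y, fun j hj => ?_, by rw [env_tmul_smul, mul_one, hxy]⟩
  obtain ⟨k, hk, hjk⟩ := h j hj
  have hkj : y * g j = g k * y := by
    rw [← mul_one (y * g j), ← hxy, ← mul_assoc, mul_assoc y, hjk, ← mul_assoc, hyx, one_mul]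
  have : commOp F g j * (x ⊗ₜ[F] MulOpposite.op y) =
      (x ⊗ₜ[F] MulOpposite.op y) * commOp F g k := by
    simp only [commOp, sub_mul, mul_sub, Algebra.TensorProduct.tmul_mul_tmul, one_mul, mul_one,
      ← MulOpposite.op_mul, hjk, hkj]
  rw [this]
  exact Ideal.mul_mem_left _ _ (Ideal.subset_span ⟨k, hk, rfl⟩)

end IsTransferable

namespace IsHeckeSeq

variable {q : F} {n : ℕ} {g : ℕ → A}

theorem isUnit (h : IsHeckeSeq q n g) (hq : q ≠ 0) {k : ℕ} (hk : k + 1 < n) : IsUnit (g k) := by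
  have h2 := h.quadratic k hk
  refine ⟨⟨g k, q⁻¹ • (g k - (q - 1) • 1), ?_, ?_⟩, rfl⟩
  · rw [mul_smul_comm, mul_sub, h2, mul_smul_comm, mul_one, add_sub_cancel_left, inv_smul_smul₀ hq]
  · rw [smul_mul_assoc, sub_mul, h2, smul_mul_assoc, one_mul, add_sub_cancel_left,
      inv_smul_smul₀ hq]

theorem isUnit_descProd (h : IsHeckeSeq q n g) (hq : q ≠ 0) (a l : ℕ) (hl : a + l < n) :
    IsUnit (descProd g a l) := by
  induction l with
  | zero => exact isUnit_one
  | succ l ih => exact (h.isUnit hq (by omega)).mul (ih (by omega))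

theorem gen_mul_descProd (h : IsHeckeSeq q n g) {a l j : ℕ} (h1 : a ≤ j) (h2 : j + 1 < a + l) :
    g j * descProd g a l = descProd g a l * g (j + 1) :=
  mul_descProd_of_up (fun i j => h.comm' i j) (fun k => by rw [← mul_assoc, h.braid]) h1 h2

/-- Conjugation by T_w for an n-cycle w shifts the indices of the generators by one, so omitting the
first point is equivalent to omitting the last. -/
theorem isTransferable_first_last (h : IsHeckeSeq q n g) (hq : q ≠ 0) :
    IsTransferable F g {k | 0 < k ∧ k + 1 < n} {k | k + 2 < n} := by
  rcases n with _ | n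
  · exact IsTransferable.of_subset fun k hk => absurd hk.2 (by omega)
  obtain ⟨u, hu⟩ := h.isUnit_descProd hq 0 n (by omega)
  refine IsTransferable.of_conj (x := ↑u⁻¹) (y := ↑u) u.inv_mul u.mul_inv ?_
  rintro j ⟨hj0, hj⟩
  obtain ⟨k, rfl⟩ : ∃ k, j = k + 1 := ⟨j - 1, by omega⟩
  refine ⟨k, (by omega : k + 2 < n + 1), ?_⟩
  have := h.gen_mul_descProd (a := 0) (l := n) (j := k) (by omega) (by omega)
  rw [← hu] at this
  rw [Units.mul_inv_eq_iff_eq_mul, mul_assoc, this, Units.inv_mul_cancel_left]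

theorem isTransferable_last_first (h : IsHeckeSeq q n g) (hq : q ≠ 0) :
    IsTransferable F g {k | k + 2 < n} {k | 0 < k ∧ k + 1 < n} := by
  rcases n with _ | n
  · exact IsTransferable.of_subset fun k (hk : k + 2 < 0) => absurd hk (by omega)
  obtain ⟨u, hu⟩ := h.isUnit_descProd hq 0 n (by omega)
  refine IsTransferable.of_conj (x := ↑u) (y := ↑u⁻¹) u.mul_inv u.inv_mul fun j hj => ?_
  have hj : j + 2 < n + 1 := hj
  refine ⟨j + 1, ⟨by omega, by omega⟩, ?_⟩
  rw [hu, h.gen_mul_descProd (by omega) (by omega)]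

end IsHeckeSeq

theorem env_zero_smul (x : A) : (0 : Env F A) • x = 0 := by
  rw [← TensorProduct.zero_tmul A (MulOpposite.op (1 : A)), env_tmul_smul, zero_mul, zero_mul]

/-- The homomorphism of enveloping algebras induced by a homomorphism of algebras. -/
def envMap {B : Type u} [Ring B] [Algebra F B] (φ : A →ₐ[F] B) : Env F A →ₐ[F] Env F B :=
  Algebra.TensorProduct.map φ (AlgHom.op φ)

theorem envMap_tmul {B : Type u} [Ring B] [Algebra F B] (φ : A →ₐ[F] B) (x y : A) :
    envMap φ (x ⊗ₜ[F] MulOpposite.op y) = φ x ⊗ₜ[F] MulOpposite.op (φ y) := rfl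

theorem envMap_smul {B : Type u} [Ring B] [Algebra F B] (φ : A →ₐ[F] B) (w : Env F A) (x : A) :
    envMap φ w • φ x = φ (w • x) := by
  induction w using TensorProduct.induction_on with
  | zero => rw [map_zero, env_zero_smul, env_zero_smul, map_zero]
  | add v w hv hw => rw [map_add, add_smul, add_smul, map_add, hv, hw]
  | tmul a b =>
    obtain ⟨b, rfl⟩ := MulOpposite.op_surjective b
    rw [envMap_tmul, env_tmul_smul, env_tmul_smul, map_mul, map_mul]

end Transferable

namespace HeckeAlgebra

variable {F A : Type u} [Field F] [Ring A] [Algebra F A] {q : F} {n : ℕ}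

theorem commute_lift {m : ℕ} {g : ℕ → A} (h : IsHeckeSeq q m g) {i : ℕ} (hin : i + n ≤ m) {z : A}
    (hz : ∀ k, k + 1 < n → Commute z (g (i + k))) (x : HeckeAlgebra F q n) :
    Commute z (lift h i n hin x) := by
  refine induction_genSeq (p := fun x => Commute z (lift h i n hin x)) (fun k hk => ?_)
    (fun r => ?_) (fun x y hx hy => ?_) (fun x y hx hy => ?_) x
  · rw [lift_genSeq h i n hin hk]; exact hz k hk
  · rw [AlgHom.commutes]; exact (Algebra.commutes r z).symm
  · rw [map_add]; exact hx.add_right hy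
  · rw [map_mul]; exact hx.mul_right hy

/-- Transfer inside a block of consecutive generators. -/
theorem isTransferable_of_block {m : ℕ} {g : ℕ → A} (h : IsHeckeSeq q m g) {i : ℕ}
    (hin : i + n ≤ m) {S S₁ S₂ : Set ℕ} (hS : IsTransferable F (genSeq q n) {k | k + 1 < n} S)
    (h₁ : ∀ j ∈ S₁, i ≤ j ∧ j + 1 < i + n ∨ j ∈ S₂ ∧ (j + 2 ≤ i ∨ i + n ≤ j))
    (h₂ : ∀ k ∈ S, k + 1 < n → i + k ∈ S₂) : IsTransferable F g S₁ S₂ := by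
  obtain ⟨w, hw, hw1⟩ := hS
  have hgen : ∀ k, k + 1 < n →
      envMap (lift h i n hin) (commOp F (genSeq q n) k) = commOp F g (i + k) := by
    intro k hk
    rw [commOp, map_sub, ← MulOpposite.op_one, envMap_tmul, envMap_tmul, map_one,
      lift_genSeq h i n hin hk]
    rfl
  refine ⟨envMap (lift h i n hin) w, fun j hj => ?_, ?_⟩
  · rcases h₁ j hj with ⟨hj1, hj2⟩ | ⟨hj1, hj2⟩
    · obtain ⟨k, rfl⟩ := Nat.exists_eq_add_of_le hj1
      rw [← hgen k (by omega), ← map_mul]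
      have hwk := hw k (show k + 1 < n by omega)
      generalize commOp F (genSeq q n) k * w = v at hwk
      induction hwk using Submodule.span_induction with
      | mem x hx =>
        obtain ⟨l, hl, rfl⟩ := hx
        by_cases hln : l + 1 < n
        · rw [hgen l hln]
          exact Ideal.subset_span ⟨i + l, h₂ l hl hln, rfl⟩
        · rw [commOp, (isHeckeSeq_genSeq q n).eq_zero l (by omega)]
          simp
      | zero => rw [map_zero]; exact zero_mem _
      | add x y _ _ hx hy => rw [map_add]; exact add_mem hx hy
      | smul c x _ hx => rw [smul_eq_mul, map_mul]; exact Ideal.mul_mem_left _ _ hx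
    · have hc : ∀ x, Commute (g j) (lift h i n hin x) :=
        commute_lift h hin fun k hk => h.comm' _ _ (by omega)
      have : commOp F g j * envMap (lift h i n hin) w =
          envMap (lift h i n hin) w * commOp F g j := by
        clear hw hw1
        induction w using TensorProduct.induction_on with
        | zero => simp
        | add v w hv hw => rw [map_add, mul_add, add_mul, hv, hw]
        | tmul a b =>
          obtain ⟨b, rfl⟩ := MulOpposite.op_surjective b
          simp only [envMap_tmul, commOp, sub_mul, mul_sub, Algebra.TensorProduct.tmul_mul_tmul,
            one_mul, mul_one, ← MulOpposite.op_mul, (hc a).eq, (hc b).eq]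
      rw [this]
      exact Ideal.mul_mem_left _ _ (Ideal.subset_span ⟨j, hj1, rfl⟩)
  · rw [← map_one (lift h i n hin), envMap_smul, hw1]

/-- Shrinking the second factor of S_a × S_{n-a} by its last point lands inside S_{n-1}. When that
factor has only one point there is nothing to shrink. -/
theorem isTransferable_right_block {a : ℕ} (han : a < n)
    (hb : 1 < n - a → IsTransferable F (genSeq q (n - a)) {k | k + 1 < n - a}
      {k | k + 2 < n - a}) :
    IsTransferable F (genSeq q n) {k | k + 1 < n ∧ k + 1 ≠ a} {k | k + 2 < n} := by
  rcases Nat.lt_or_ge 1 (n - a) with h | h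
  · refine isTransferable_of_block (isHeckeSeq_genSeq q n) (i := a) (by omega) (hb h)
      (fun j hj => ?_) fun k hk hk' => ?_
    · have := hj.1
      have := hj.2
      rcases Nat.lt_or_ge j a with hja | hja
      · exact Or.inr ⟨show j + 2 < n by omega, by omega⟩
      · exact Or.inl ⟨hja, by omega⟩
    · have : k + 2 < n - a := hk
      exact show a + k + 2 < n by omega
  · refine IsTransferable.of_subset fun k hk => ?_
    have := hk.1
    have := hk.2
    exact show k + 2 < n by omega

/-! ### Descent to the parabolic subgroup of type (e, …, e) in characteristic zero. -/

section CharZero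

variable [CharZero F] {e : ℕ}

/-- Since 1 lies in `traceIdeal`, it is a combination, with central coefficients, of traces of
elements centralised by maximal parabolics. Composing each trace with the given transfer and adding
up yields an operator fixing 1. -/
theorem isTransferable_of_maximal (he : 1 < e) (hq : IsPrimitiveRoot q e) (hn : 1 < n)
    (hne : n ≠ e) {S : Set ℕ}
    (hS : ∀ a, 0 < a → a < n → IsTransferable F (genSeq q n) {k | k + 1 < n ∧ k + 1 ≠ a} S) :
    IsTransferable F (genSeq q n) {k | k + 1 < n} S := by
  have hq0 : q ≠ 0 := hq.ne_zero (by omega)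
  have h1 : (1 : Subalgebra.center F (HeckeAlgebra F q n)) ∈ traceIdeal q n := by
    rw [traceIdeal_eq_top he hq hn hne]; trivial
  have key : ∀ z ∈ traceIdeal q n, ∃ w : Env F (HeckeAlgebra F q n),
      (∀ j, j + 1 < n → commOp F (genSeq q n) j * w ∈
        Ideal.span (commOp F (genSeq q n) '' S)) ∧ w • (1 : HeckeAlgebra F q n) = z := by
    intro z hz
    induction hz using Submodule.span_induction with
    | mem z hz =>
      obtain ⟨a, x, ha, han, hx, hz⟩ := hz
      obtain ⟨w, hw, hw1⟩ := hS a ha han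
      -- Read from the right: transfer to S_a × S_{n-a}, multiply by x, which respects that
      -- centraliser, then apply the relative trace.
      refine ⟨relTrace (conjOp q (genSeq q n)) a (n - a) * (x ⊗ₜ[F] 1) * w, fun j hj => ?_, ?_⟩
      · have h2 := ((isHeckeSeq_genSeq q n).isTransferSeq hq0).delta_mul_relTrace
          (a := a) (b := n - a) (k := j) (by omega)
        rw [Nat.add_sub_cancel' han.le] at h2
        rw [← mul_assoc, ← mul_assoc]
        refine mul_mem_span_commOp hw (mul_mem_span_commOp (fun k hk => ?_) h2)
        rw [← (commute_tmul_one_commOp (hx k hk.1 hk.2)).eq]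
        exact Ideal.mul_mem_left _ _ (Ideal.subset_span ⟨k, hk, rfl⟩)
      · rw [mul_smul, hw1, mul_smul, ← MulOpposite.op_one, env_tmul_smul, mul_one, mul_one, hz]
    | zero => exact ⟨0, fun j _ => by rw [mul_zero]; exact zero_mem _, env_zero_smul _⟩
    | add x y _ _ hx hy =>
      obtain ⟨v, hv, hv1⟩ := hx
      obtain ⟨w, hw, hw1⟩ := hy
      exact ⟨v + w, fun j hj => by rw [mul_add]; exact add_mem (hv j hj) (hw j hj),
        by rw [add_smul, hv1, hw1]; rfl⟩
    | smul c x _ hx =>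
      obtain ⟨w, hw, hw1⟩ := hx
      refine ⟨(c : HeckeAlgebra F q n) ⊗ₜ[F] 1 * w, fun j hj => ?_, ?_⟩
      · rw [← mul_assoc, ← (commute_tmul_one_commOp
          (Subalgebra.mem_center_iff.1 c.2 (genSeq q n j)).symm).eq, mul_assoc]
        exact Ideal.mul_mem_left _ _ (hw j hj)
      · rw [mul_smul, hw1, ← MulOpposite.op_one, env_tmul_smul, mul_one]; rfl
  obtain ⟨w, hw, hw1⟩ := key 1 h1
  exact ⟨w, hw, hw1⟩

/-- If e does not divide n, then in each S_a × S_{n-a} one of the two sizes is not divisible by e,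
and that factor loses a point by induction. -/
theorem isTransferable_remove_last (he : 1 < e) (hq : IsPrimitiveRoot q e) (n : ℕ) (hn : 1 < n)
    (hen : ¬ e ∣ n) : IsTransferable F (genSeq q n) {k | k + 1 < n} {k | k + 2 < n} := by
  induction n using Nat.strong_induction_on with
  | _ n ih =>
    have hq0 : q ≠ 0 := hq.ne_zero (by omega)
    have hg := isHeckeSeq_genSeq q n
    refine isTransferable_of_maximal he hq hn (fun h => hen (h ▸ dvd_rfl)) fun a ha han => ?_
    by_cases hb : e ∣ n - a
    · have hea : ¬ e ∣ a := fun h => hen (by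
        have := dvd_add h hb
        rwa [Nat.add_sub_cancel' han.le] at this)
      -- The left factor must shrink, so its omitted point is moved to the front by conjugation, and
      -- then to the end of the whole range.
      refine IsTransferable.trans ?_ (hg.isTransferable_first_last hq0)
      rcases Nat.lt_or_ge 1 a with ha1 | ha1
      · refine isTransferable_of_block hg (i := 0) (n := a) (by omega) ((ih a han ha1 hea).trans
          ((isHeckeSeq_genSeq q a).isTransferable_last_first hq0)) (fun j hj => ?_)
          fun k hk _ => ⟨by have := hk.1; omega, by omega⟩
        have := hj.1
        have := hj.2
        rcases Nat.lt_or_ge j a with hja | hja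
        · exact Or.inl ⟨by omega, by omega⟩
        · exact Or.inr ⟨⟨by omega, by omega⟩, by omega⟩
      · exact IsTransferable.of_subset fun k hk => ⟨by have := hk.2; omega, hk.1⟩
    · exact isTransferable_right_block han fun h => ih (n - a) (by omega) h hb

/-- Points are dropped one at a time from S_{de-1}. The sizes de - 1, …, de - r are not multiples of
e because r < e, so `isTransferable_remove_last` applies at each stage. -/
theorem isTransferable_remove_many (he : 1 < e) (hq : IsPrimitiveRoot q e) {d : ℕ} (hd : 1 < d)
    (r : ℕ) (hr : r < e) : IsTransferable F (genSeq q (d * e)) {k | k + 2 < d * e}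
      {k | k + 2 + r < d * e} := by
  have hde : 2 * e ≤ d * e := Nat.mul_le_mul_right e hd
  induction r with
  | zero => exact IsTransferable.of_subset fun k hk => hk
  | succ r ih =>
    refine (ih (by omega)).trans ?_
    have hnd : ¬ e ∣ d * e - (r + 1) := fun h => by
      have h2 := (Nat.dvd_sub_iff_right (by omega) (dvd_mul_left e d)).1 h
      exact absurd (Nat.le_of_dvd (by omega) h2) (by omega)
    refine isTransferable_of_block (isHeckeSeq_genSeq q (d * e)) (i := 0) (n := d * e - (r + 1))
      (by omega) (isTransferable_remove_last he hq _ (by omega) hnd) (fun j hj => ?_)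
      fun k hk hk' => ?_
    · have : j + 2 + r < d * e := hj
      exact Or.inl ⟨by omega, by omega⟩
    · have : k + 2 < d * e - (r + 1) := hk
      exact show 0 + k + 2 + (r + 1) < d * e by omega

/-- In characteristic zero everything is transferred from the parabolic subgroup of
type `(e, …, e)`. -/
theorem isTransferable_rect (he : 1 < e) (hq : IsPrimitiveRoot q e) (d : ℕ) (hd : 0 < d) :
    IsTransferable F (genSeq q (d * e)) {k | k + 1 < d * e}
      {k | k + 1 < d * e ∧ ¬ e ∣ k + 1} := by
  induction d using Nat.strong_induction_on with
  | _ d ih =>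
    have hg := isHeckeSeq_genSeq q (d * e)
    rcases Nat.lt_or_ge 1 d with hd1 | hd1
    swap
    · obtain rfl : d = 1 := by omega
      refine IsTransferable.of_subset fun k (hk : k + 1 < 1 * e) => ⟨hk, fun h => ?_⟩
      exact absurd (Nat.le_of_dvd (by omega) h) (by omega)
    have hde : 2 * e ≤ d * e := Nat.mul_le_mul_right e hd1
    -- When e divides a, the induction hypothesis applies to both factors of S_a × S_{de-a}, one
    -- after the other.
    have hdvd : ∀ a', 0 < a' → a' < d → IsTransferable F (genSeq q (d * e))
        {k | k + 1 < d * e ∧ k + 1 ≠ a' * e} {k | k + 1 < d * e ∧ ¬ e ∣ k + 1} := by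
      intro a' ha' had
      have hle : a' * e + (d - a') * e = d * e := by
        rw [← add_mul, Nat.add_sub_cancel' had.le]
      have step1 : IsTransferable F (genSeq q (d * e)) {k | k + 1 < d * e ∧ k + 1 ≠ a' * e}
          {k | k + 1 < d * e ∧ k + 1 ≠ a' * e ∧ (k + 1 < a' * e → ¬ e ∣ k + 1)} := by
        refine isTransferable_of_block hg (i := 0) (n := a' * e) (by omega) (ih a' had ha')
          (fun j hj => ?_) fun k hk _ => ⟨by omega, by omega, fun _ => by
            rw [zero_add]; exact hk.2⟩
        have := hj.1
        have := hj.2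
        rcases Nat.lt_or_ge j (a' * e) with hja | hja
        · exact Or.inl ⟨by omega, by omega⟩
        · exact Or.inr ⟨⟨by omega, by omega, by omega⟩, by omega⟩
      refine step1.trans (isTransferable_of_block hg (i := a' * e) (n := (d - a') * e) (by omega)
        (ih (d - a') (by omega) (by omega)) (fun j hj => ?_) fun k hk _ => ⟨by omega, ?_⟩)
      · have := hj.1
        have := hj.2.1
        rcases Nat.lt_or_ge j (a' * e) with hja | hja
        · exact Or.inr ⟨⟨by omega, hj.2.2 (by omega)⟩, by omega⟩
        · exact Or.inl ⟨by omega, by omega⟩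
      · rw [add_assoc, Nat.dvd_add_right (dvd_mul_left e a')]
        exact hk.2
    refine isTransferable_of_maximal he hq (by omega) ?_ fun a ha han => ?_
    · omega
    by_cases hea : e ∣ a
    · obtain ⟨a', rfl⟩ := exists_eq_mul_left_of_dvd hea
      exact hdvd a' (Nat.pos_of_mul_pos_right ha) (Nat.lt_of_mul_lt_mul_right han)
    · have hb : ¬ e ∣ d * e - a := fun h =>
        hea ((Nat.dvd_sub_iff_right han.le (dvd_mul_left e d)).1 h)
      -- Otherwise e does not divide de - a either. One point is dropped to reach S_{de-1}, then e -
      -- 1 more to reach S_{(d-1)e}. This lies in S_{(d-1)e} × S_e, which the previous case covers.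
      refine (isTransferable_right_block han fun h =>
        isTransferable_remove_last he hq _ h hb).trans
        ((isTransferable_remove_many he hq hd1 (e - 1) (by omega)).trans
          (IsTransferable.trans (IsTransferable.of_subset fun k hk => ?_)
            (hdvd (d - 1) (by omega) (by omega))))
      have hk : k + 2 + (e - 1) < d * e := hk
      have : (d - 1) * e + e = d * e := by
        rw [← Nat.succ_mul, Nat.succ_eq_add_one, Nat.sub_add_cancel hd1.le]
      exact ⟨by omega, by omega⟩

end CharZero

end HeckeAlgebra

/-! ## Parabolic subalgebras -/

namespace HeckeAlgebra

variable {F : Type u} [Field F] {q : F} {n : ℕ}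

theorem simpleTransposition_injective :
    Function.Injective (simpleTransposition : Fin (n - 1) → Equiv.Perm (Fin n)) := by
  intro i j hij
  have h1 := congr_arg Fin.val (Equiv.congr_fun hij ⟨i, by omega⟩)
  simp only [simpleTransposition, Equiv.swap_apply_left] at h1
  rw [Equiv.swap_apply_def] at h1
  ext
  split_ifs at h1 with h2 h3 <;> simp only [Fin.ext_iff] at * <;> omega

theorem simpleTransposition_ne_one (i : Fin (n - 1)) : simpleTransposition i ≠ 1 := by
  intro h
  have h1 := Equiv.congr_fun h ⟨i, by omega⟩
  simp [simpleTransposition] at h1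

/-- The chosen reduced word is opaque, but minimality against the one-letter word bounds its length
by 1, and it is not empty because s_i ≠ 1. -/
theorem T_simpleTransposition (i : Fin (n - 1)) : T q (simpleTransposition i) = gen q i := by
  obtain ⟨h1, h2⟩ := (exists_reducedWord (simpleTransposition i)).choose_spec
  have h3 := h2 [i] (by simp)
  rw [T]
  generalize (exists_reducedWord (simpleTransposition i)).choose = l at h1 h3
  match l, h3 with
  | [], _ => exact absurd h1.symm (simpleTransposition_ne_one i)
  | [j], _ =>
    rw [List.map_singleton, List.prod_singleton] at h1 ⊢
    rw [simpleTransposition_injective h1]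

theorem index_eq_index_succ (c : Composition n) {k : ℕ} (hk : k + 1 < n)
    (hc : ∀ i, c.sizeUpTo i ≠ k + 1) : c.index ⟨k, by omega⟩ = c.index ⟨k + 1, hk⟩ := by
  rw [← c.mem_range_embedding_iff', c.mem_range_embedding_iff]
  have h1 := c.sizeUpTo_index_le ⟨k, by omega⟩
  have h2 := c.lt_sizeUpTo_index_succ ⟨k, by omega⟩
  simp only [] at h1 h2
  exact ⟨by simp only []; omega, lt_of_le_of_ne h2 (hc _).symm⟩

theorem simpleTransposition_mem_parabolicSubgroup (c : Composition n) {k : ℕ} (hk : k < n - 1)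
    (hc : ∀ i, c.sizeUpTo i ≠ k + 1) : simpleTransposition ⟨k, hk⟩ ∈ parabolicSubgroup c := by
  intro i
  have h := index_eq_index_succ c (by omega) hc
  rw [simpleTransposition, Equiv.swap_apply_def]
  split_ifs with h1 h2
  · rw [h1, h]
  · rw [h2, h]
  · rfl

/-- The condition on partial sums says that positions k and k + 1 are not separated by a block
boundary. -/
theorem genSeq_mem_parabolicSubalgebra (c : Composition n) {k : ℕ}
    (hc : ∀ i, c.sizeUpTo i ≠ k + 1) : genSeq q n k ∈ parabolicSubalgebra q c := by
  by_cases hk : k < n - 1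
  · rw [genSeq_of_lt hk, ← T_simpleTransposition]
    exact Algebra.subset_adjoin ⟨_, simpleTransposition_mem_parabolicSubgroup c hk hc, rfl⟩
  · rw [show genSeq q n k = 0 from dif_neg hk]
    exact zero_mem _

/-! ## Bimodule homomorphisms given by central vectors -/

section CentralVector

variable {V : Type*} [AddCommGroup V] [Module (Env F (HeckeAlgebra F q n)) V]

theorem right_smul_eq_left_smul {v : V}
    (hv : ∀ k, k + 1 < n → commOp F (genSeq q n) k • v = 0) (y : HeckeAlgebra F q n) :
    (1 ⊗ₜ[F] MulOpposite.op y : Env F (HeckeAlgebra F q n)) • v =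
      (y ⊗ₜ[F] 1 : Env F (HeckeAlgebra F q n)) • v := by
  refine induction_genSeq (p := fun y => (1 ⊗ₜ[F] MulOpposite.op y :
    Env F (HeckeAlgebra F q n)) • v = (y ⊗ₜ[F] 1 : Env F (HeckeAlgebra F q n)) • v)
    (fun k hk => ?_) (fun r => ?_) (fun x y hx hy => ?_) (fun x y hx hy => ?_) y
  · have := hv k hk
    rw [commOp, sub_smul, sub_eq_zero] at this
    exact this.symm
  · rw [Algebra.algebraMap_eq_smul_one, MulOpposite.op_smul, MulOpposite.op_one,
      TensorProduct.tmul_smul, TensorProduct.smul_tmul']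
  · rw [MulOpposite.op_add, TensorProduct.tmul_add, TensorProduct.add_tmul, add_smul, add_smul,
      hx, hy]
  · have h1 : (1 ⊗ₜ[F] MulOpposite.op (x * y) : Env F (HeckeAlgebra F q n)) =
        (1 ⊗ₜ[F] MulOpposite.op y) * (1 ⊗ₜ[F] MulOpposite.op x) := by
      rw [Algebra.TensorProduct.tmul_mul_tmul, one_mul, MulOpposite.op_mul]
    have h2 : (1 ⊗ₜ[F] MulOpposite.op y : Env F (HeckeAlgebra F q n)) * (x ⊗ₜ[F] 1) =
        (x ⊗ₜ[F] 1) * (1 ⊗ₜ[F] MulOpposite.op y) := by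
      simp only [Algebra.TensorProduct.tmul_mul_tmul, one_mul, mul_one]
    rw [h1, mul_smul, hx, smul_smul, h2, mul_smul, hy, smul_smul,
      Algebra.TensorProduct.tmul_mul_tmul, one_mul]

/-- The homomorphism of bimodules `h ↦ h v` for a vector `v` that commutes with the generators. -/
def toBimodule (v : V) (hv : ∀ k, k + 1 < n → commOp F (genSeq q n) k • v = 0) :
    HeckeAlgebra F q n →ₗ[Env F (HeckeAlgebra F q n)] V where
  toFun h := (h ⊗ₜ[F] 1 : Env F (HeckeAlgebra F q n)) • v
  map_add' x y := by rw [TensorProduct.add_tmul, add_smul]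
  map_smul' e h := by
    rw [RingHom.id_apply]
    induction e using TensorProduct.induction_on with
    | zero =>
      rw [env_zero_smul, TensorProduct.zero_tmul]
      exact (zero_smul (Env F (HeckeAlgebra F q n)) v).trans
        (zero_smul (Env F (HeckeAlgebra F q n))
          ((h ⊗ₜ[F] 1 : Env F (HeckeAlgebra F q n)) • v)).symm
    | add x y hx hy => rw [add_smul, TensorProduct.add_tmul, add_smul, add_smul, hx, hy]
    | tmul a b =>
      obtain ⟨b, rfl⟩ := MulOpposite.op_surjective b
      rw [env_tmul_smul, smul_smul, Algebra.TensorProduct.tmul_mul_tmul, mul_one]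
      have h1 : ∀ x y : HeckeAlgebra F q n, (x ⊗ₜ[F] MulOpposite.op y :
          Env F (HeckeAlgebra F q n)) = (x ⊗ₜ[F] 1) * (1 ⊗ₜ[F] MulOpposite.op y) := fun x y => by
        rw [Algebra.TensorProduct.tmul_mul_tmul, one_mul, mul_one]
      rw [h1 (a * h), mul_smul, right_smul_eq_left_smul hv, smul_smul,
        Algebra.TensorProduct.tmul_mul_tmul, one_mul]

theorem toBimodule_apply (v : V) (hv : ∀ k, k + 1 < n → commOp F (genSeq q n) k • v = 0)
    (h : HeckeAlgebra F q n) :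
    toBimodule v hv h = (h ⊗ₜ[F] 1 : Env F (HeckeAlgebra F q n)) • v := rfl

theorem commOp_smul_smul_eq_zero {S : Set ℕ} {w : Env F (HeckeAlgebra F q n)}
    (hw : ∀ k, k + 1 < n → commOp F (genSeq q n) k * w ∈
      Ideal.span (commOp F (genSeq q n) '' S)) {v : V}
    (hv : ∀ k ∈ S, commOp F (genSeq q n) k • v = 0) (k : ℕ) (hk : k + 1 < n) :
    commOp F (genSeq q n) k • w • v = 0 := by
  rw [smul_smul]
  exact smul_eq_zero_of_mem_span_commOp (hw k hk) hv

end CentralVector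

theorem commOp_mem_envSubalgebra {A' : Subalgebra F (HeckeAlgebra F q n)} {k : ℕ}
    (hk : genSeq q n k ∈ A') : commOp F (genSeq q n) k ∈ envSubalgebra A' A' :=
  sub_mem ⟨⟨_, hk⟩ ⊗ₜ[F] 1, by simp⟩
    ⟨1 ⊗ₜ[F] ⟨MulOpposite.op (genSeq q n k), hk⟩, by simp⟩

/-- A criterion for relative projectivity of a bimodule that embeds into the Hecke algebra. -/
theorem isRelativelyProjectiveBimodule_of_operator {S : Set ℕ}
    {A' : Subalgebra F (HeckeAlgebra F q n)} (hA' : ∀ k ∈ S, genSeq q n k ∈ A')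
    {M : Type u} [AddCommGroup M] [Module (Env F (HeckeAlgebra F q n)) M]
    (ι : M →ₗ[Env F (HeckeAlgebra F q n)] HeckeAlgebra F q n) (m₀ : M)
    (hι : ∀ m, (ι m ⊗ₜ[F] 1 : Env F (HeckeAlgebra F q n)) • m₀ = m)
    (hm₀ : ∀ k, commOp F (genSeq q n) k • m₀ = 0) {w : Env F (HeckeAlgebra F q n)}
    (hw : ∀ k, k + 1 < n → commOp F (genSeq q n) k * w ∈
      Ideal.span (commOp F (genSeq q n) '' S)) (hw₀ : w • m₀ = m₀) :
    IsRelativelyProjectiveBimodule A' A' M := by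
  intro V W _ _ _ _ α β _ ⟨γ, hγ⟩
  -- γ is linear only over the smaller enveloping algebra, but that contains the commutators with
  -- the generators in S. So γ m₀ is centralised by them, and w makes it centralised by all
  -- generators.
  have hv : ∀ k ∈ S, commOp F (genSeq q n) k • γ m₀ = 0 := by
    intro k hk
    have h1 := γ.map_smul ⟨_, commOp_mem_envSubalgebra (hA' k hk)⟩ m₀
    have h2 : (⟨_, commOp_mem_envSubalgebra (hA' k hk)⟩ : envSubalgebra A' A') • m₀ = 0 := hm₀ k
    rw [h2, map_zero] at h1
    exact h1.symm
  refine ⟨(toBimodule (w • γ m₀) (commOp_smul_smul_eq_zero hw hv)).comp ι, fun m => ?_⟩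
  rw [LinearMap.comp_apply, toBimodule_apply, map_smul, map_smul, hγ, ← map_smul, hw₀, ← map_smul,
    hι]

theorem sizeUpTo_rectComposition (d e : ℕ) (he : 0 < e) (i : ℕ) :
    e ∣ (rectComposition d e he).sizeUpTo i := by
  simp [Composition.sizeUpTo, rectComposition, List.take_replicate]

theorem isRelativelyProjectiveBimodule_rect [CharZero F] {e : ℕ} (he : 1 < e)
    (hq : IsPrimitiveRoot q e) (d : ℕ) :
    IsRelativelyProjectiveBimodule (parabolicSubalgebra q (rectComposition d e (by omega)))
      (parabolicSubalgebra q (rectComposition d e (by omega))) (HeckeAlgebra F q (d * e)) := by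
  obtain ⟨w, hw, hw1⟩ : IsTransferable F (genSeq q (d * e)) {k | k + 1 < d * e}
      {k | k + 1 < d * e ∧ ¬ e ∣ k + 1} := by
    rcases Nat.eq_zero_or_pos d with rfl | hd
    · exact IsTransferable.of_subset fun k (hk : k + 1 < 0 * e) => by omega
    · exact isTransferable_rect he hq d hd
  refine isRelativelyProjectiveBimodule_of_operator (fun k hk => genSeq_mem_parabolicSubalgebra _
    fun i hi => hk.2 (hi ▸ sizeUpTo_rectComposition d e _ i)) LinearMap.id 1 (fun m => ?_)
    (fun k => ?_) hw hw1
  · rw [← MulOpposite.op_one, env_tmul_smul, LinearMap.id_apply, mul_one, mul_one]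
  · rw [commOp_smul, mul_one, one_mul, sub_self]

end HeckeAlgebra

theorem isIsoToDirectSummand_of_retraction {R M N : Type u} [Ring R] [AddCommGroup M] [Module R M]
    [AddCommGroup N] [Module R N] (s : M →ₗ[R] N) (r : N →ₗ[R] M) (h : ∀ m, r (s m) = m) :
    IsIsoToDirectSummand R M N := by
  refine ⟨LinearMap.range s, LinearMap.ker (s.rangeRestrict.comp r),
    LinearMap.isCompl_of_proj fun x => ?_,
    ⟨LinearEquiv.ofInjective s (Function.LeftInverse.injective h)⟩⟩
  obtain ⟨_, m, rfl⟩ := x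
  exact Subtype.ext (by simp [h])

/-! ### The multiplication map on the balanced tensor product. -/

section Multiplication

variable {F A : Type u} [Field F] [Ring A] [Algebra F A]

theorem env_smul_mul_left_right (a b x : A) (y : A) :
    (a ⊗ₜ[F] MulOpposite.op b : Env F A) • (x * y) =
      ((a ⊗ₜ[F] (1 : Aᵐᵒᵖ) : Env F A) • x) * (((1 : A) ⊗ₜ[F] MulOpposite.op b : Env F A) • y) := by
  rw [← MulOpposite.op_one, env_tmul_smul, env_tmul_smul, env_tmul_smul]
  simp [mul_assoc]

variable (P Q : Submodule (Env F A) A)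

/-- The multiplication of two subbimodules, as a linear map. -/
def mulLinear : P ⊗[F] Q →ₗ[F] A :=
  TensorProduct.lift ((LinearMap.mul F A).compl₁₂ (P.subtype.restrictScalars F)
    (Q.subtype.restrictScalars F))

theorem mulLinear_outerAction (e : Env F A) (x : P ⊗[F] Q) :
    mulLinear P Q (outerAction F A P Q e x) = e • mulLinear P Q x := by
  induction e using TensorProduct.induction_on with
  | zero => rw [map_zero, env_zero_smul, LinearMap.zero_apply, map_zero]
  | add e e' h h' => rw [map_add, add_smul, LinearMap.add_apply, map_add, h, h']
  | tmul a b =>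
    obtain ⟨b, rfl⟩ := MulOpposite.op_surjective b
    induction x using TensorProduct.induction_on with
    | zero => rw [map_zero, map_zero, smul_zero]
    | add x y hx hy => rw [map_add, map_add, map_add, hx, hy, smul_add]
    | tmul m n =>
      rw [outerAction_tmul]
      exact (env_smul_mul_left_right a b (m : A) (n : A)).symm

/-- The multiplication of two subbimodules, on the outer tensor product. -/
def outerMul : OuterTensor F P Q →ₗ[Env F A] A where
  toFun := mulLinear P Q
  map_add' := map_add (mulLinear P Q)
  map_smul' := mulLinear_outerAction P Q

variable {P Q}

/-- A pure tensor, in the outer tensor product. -/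
def outerTmul (m : P) (n : Q) : OuterTensor F P Q := TensorProduct.tmul F m n

theorem outerMul_outerTmul (m : P) (n : Q) : outerMul P Q (outerTmul m n) = (m : A) * n := rfl

theorem smul_outerTmul (a b : A) (m : P) (n : Q) :
    (a ⊗ₜ[F] MulOpposite.op b : Env F A) • outerTmul m n =
      outerTmul ((a ⊗ₜ[F] (1 : Aᵐᵒᵖ) : Env F A) • m)
        (((1 : A) ⊗ₜ[F] MulOpposite.op b : Env F A) • n) :=
  outerAction_tmul F A P Q a (MulOpposite.op b) m n

theorem outerTmul_sub_mem {A' : Subalgebra F A} {a : A} (ha : a ∈ A') (m : P) (n : Q) :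
    outerTmul (((1 : A) ⊗ₜ[F] MulOpposite.op a : Env F A) • m) n -
      outerTmul m ((a ⊗ₜ[F] (1 : Aᵐᵒᵖ) : Env F A) • n) ∈ balancingSubmodule F A P Q A' :=
  Submodule.subset_span ⟨m, a, n, ha, rfl⟩

variable (P Q)

/-- The multiplication of two subbimodules, on the tensor product over a subalgebra. -/
def tensorOverMul (A' : Subalgebra F A) : TensorOver F A P Q A' →ₗ[Env F A] A :=
  Submodule.liftQ _ (outerMul P Q) (Submodule.span_le.2 fun x hx => by
    obtain ⟨m, a, n, -, hx⟩ := hx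
    have hx' : x = outerTmul (((1 : A) ⊗ₜ[F] MulOpposite.op a : Env F A) • m) n -
      outerTmul m ((a ⊗ₜ[F] (1 : Aᵐᵒᵖ) : Env F A) • n) := hx
    rw [SetLike.mem_coe, LinearMap.mem_ker, hx', map_sub, outerMul_outerTmul, outerMul_outerTmul,
      Submodule.coe_smul, Submodule.coe_smul,
      ← MulOpposite.op_one, env_tmul_smul, env_tmul_smul, sub_eq_zero]
    simp [mul_assoc])

theorem tensorOverMul_mk (A' : Subalgebra F A) (m : P) (n : Q) :
    tensorOverMul P Q A' (Submodule.Quotient.mk (outerTmul m n)) = (m : A) * n :=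
  rfl

end Multiplication

/-! ## Blocks -/

section Block

variable {F A : Type u} [Field F] [Ring A] [Algebra F A]

/-- In a block, a central element that is not killed by a character of the block is invertible. -/
theorem IsBlockIdempotent.exists_inverse [Module.Finite F A] {f c : A} (hf : IsBlockIdempotent f)
    (ε : A →ₐ[F] F) (hεf : ε f = 1) (hc : c ∈ Subalgebra.center F A) (hεc : ε c ≠ 0) :
    ∃ c' ∈ Subalgebra.center F A, c' * c = f := by
  have hfz : f ∈ Subalgebra.center F A := Subalgebra.mem_center_iff.2 fun a => (hf.central a).symm
  let r : Subalgebra.center F A := ⟨c * f, mul_mem hc hfz⟩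
  have : IsArtinianRing (Subalgebra.center F A) := IsArtinianRing.of_finite F _
  obtain ⟨n, y, hy⟩ := IsArtinian.exists_pow_succ_smul_dvd r (1 : Subalgebra.center F A)
  simp only [smul_eq_mul, mul_one] at hy
  have h1 : ∀ k, r ^ n = r ^ (n + k) * y ^ k := by
    intro k
    induction k with
    | zero => simp
    | succ k ih =>
      calc r ^ n = r ^ n * r ^ k * y ^ k := by rw [← pow_add]; exact ih
        _ = r ^ (n + 1) * y * r ^ k * y ^ k := by rw [hy]
        _ = _ := by ring
  -- Fitting's argument: the powers of r = c f stabilise, and g is the idempotent cutting out the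
  -- part where r is invertible. As g lies below f it is 0 or f. If g = 0 then r is nilpotent,
  -- contradicting ε r ≠ 0.
  let g : Subalgebra.center F A := r ^ (n + 1) * y ^ (n + 1)
  have hr : r ^ (n + 1) = r ^ (n + 1) * g := by
    calc r ^ (n + 1) = r ^ n * r := pow_succ _ _
      _ = r ^ (n + (n + 1)) * y ^ (n + 1) * r := by rw [← h1]
      _ = _ := by simp only [g]; ring
  have hgg : g * g = g := by
    calc g * g = r ^ (n + 1) * g * y ^ (n + 1) := by simp only [g]; ring
      _ = g := by rw [← hr]
  have hfr : f * (r : A) = r := by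
    change f * (c * f) = c * f
    rw [hf.central, mul_assoc, hf.idem]
  have hfg : f * (g : A) = g := by
    change f * ((r ^ (n + 1) * y ^ (n + 1) : Subalgebra.center F A) : A) = _
    change f * ((r : A) ^ (n + 1) * (y : A) ^ (n + 1)) = (r : A) ^ (n + 1) * (y : A) ^ (n + 1)
    rw [pow_succ' (r : A) n, ← mul_assoc, ← mul_assoc, hfr]
  rcases hf.primitive g (congr_arg Subtype.val hgg)
    (fun a => (Subalgebra.mem_center_iff.1 g.2 a).symm) hfg with hg | hg
  · exfalso
    have hg' : g = 0 := Subtype.ext hg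
    rw [hg', mul_zero] at hr
    have h2 : (c * f) ^ (n + 1) = 0 := congr_arg Subtype.val hr
    have h3 := congr_arg ε h2
    rw [map_pow, map_mul, hεf, mul_one, map_zero] at h3
    exact hεc (pow_eq_zero_iff (by omega) |>.1 h3)
  · refine ⟨f * (r : A) ^ n * (y : A) ^ (n + 1),
      mul_mem (mul_mem hfz (pow_mem r.2 _)) (pow_mem y.2 _), ?_⟩
    have hyc : (y : A) ^ (n + 1) ∈ Subalgebra.center F A := pow_mem y.2 _
    have hrc : (r : A) ^ n ∈ Subalgebra.center F A := pow_mem r.2 _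
    calc f * (r : A) ^ n * (y : A) ^ (n + 1) * c
        = c * f * (r : A) ^ n * (y : A) ^ (n + 1) := by
          rw [Subalgebra.mem_center_iff.1 hc]; simp only [mul_assoc]
      _ = g := by
          change (r : A) * (r : A) ^ n * (y : A) ^ (n + 1) = (r : A) ^ (n + 1) * (y : A) ^ (n + 1)
          rw [pow_succ' (r : A) n]
      _ = f := hg

theorem IsBlockIdempotent.mul_of_mem {f b : A} (hf : IsBlockIdempotent f)
    (hb : b ∈ blockBimodule F f) : b * f = b := by
  induction hb using Submodule.span_induction with
  | mem x hx => rw [Set.mem_singleton_iff.1 hx, hf.idem]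
  | zero => exact zero_mul f
  | add x y _ _ hx hy => rw [add_mul, hx, hy]
  | smul e x _ hx =>
    induction e using TensorProduct.induction_on with
    | zero => rw [env_zero_smul, zero_mul]
    | add e e' h h' => rw [add_smul, add_mul, h, h']
    | tmul a b =>
      obtain ⟨b, rfl⟩ := MulOpposite.op_surjective b
      rw [env_tmul_smul, mul_assoc, ← hf.central, ← mul_assoc, mul_assoc a, hx]

end Block

namespace HeckeAlgebra

variable {F : Type u} [Field F] {q : F} {n : ℕ}

/-- Balancing makes f ⊗ f commute with the generators lying in A', so w (f ⊗ f) commutes with all of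
H. Multiplication sends it to w f = f, hence b ↦ b · w (f ⊗ f) is a section of multiplication. -/
theorem isIsoToDirectSummand_block {S : Set ℕ} {A' : Subalgebra F (HeckeAlgebra F q n)}
    (hA' : ∀ k ∈ S, genSeq q n k ∈ A') {f : HeckeAlgebra F q n} (hf : IsBlockIdempotent f)
    {w : Env F (HeckeAlgebra F q n)}
    (hw : ∀ k, k + 1 < n → commOp F (genSeq q n) k * w ∈
      Ideal.span (commOp F (genSeq q n) '' S)) (hwf : w • f = f) :
    IsIsoToDirectSummand (Env F (HeckeAlgebra F q n)) (blockBimodule F f)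
      (TensorOver F (HeckeAlgebra F q n) (blockBimodule F f) (blockBimodule F f) A') := by
  have hff : f ∈ blockBimodule F f := Submodule.mem_span_singleton_self f
  let f' : blockBimodule F f := ⟨f, hff⟩
  let v : TensorOver F (HeckeAlgebra F q n) (blockBimodule F f) (blockBimodule F f) A' :=
    Submodule.Quotient.mk (outerTmul f' f')
  have hcomm : ∀ a : HeckeAlgebra F q n,
      ((a ⊗ₜ[F] MulOpposite.op (1 : HeckeAlgebra F q n) : Env F (HeckeAlgebra F q n)) • f' =
        ((1 : HeckeAlgebra F q n) ⊗ₜ[F] MulOpposite.op a : Env F (HeckeAlgebra F q n)) • f') :=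
    fun a => Subtype.ext (by
      rw [Submodule.coe_smul, Submodule.coe_smul, env_tmul_smul, env_tmul_smul]
      simp [f', hf.central])
  have hv : ∀ k ∈ S, commOp F (genSeq q n) k • v = 0 := by
    intro k hk
    have h3 : ((1 : HeckeAlgebra F q n) ⊗ₜ[F] MulOpposite.op (1 : HeckeAlgebra F q n) :
        Env F (HeckeAlgebra F q n)) • f' = f' := one_smul (Env F (HeckeAlgebra F q n)) f'
    have h2 : commOp F (genSeq q n) k • outerTmul f' f' =
        outerTmul (((1 : HeckeAlgebra F q n) ⊗ₜ[F] MulOpposite.op (genSeq q n k) :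
            Env F (HeckeAlgebra F q n)) • f') f' -
          outerTmul f' ((genSeq q n k ⊗ₜ[F] (1 : (HeckeAlgebra F q n)ᵐᵒᵖ) :
            Env F (HeckeAlgebra F q n)) • f') := by
      unfold commOp
      rw [sub_smul, ← MulOpposite.op_one, smul_outerTmul, smul_outerTmul, ← MulOpposite.op_one, h3,
        hcomm]
    change Submodule.Quotient.mk (commOp F (genSeq q n) k • outerTmul f' f') = _
    rw [h2, Submodule.Quotient.mk_eq_zero]
    exact outerTmul_sub_mem (hA' k hk) f' f'
  have hcf : ∀ k, k + 1 < n → commOp F (genSeq q n) k • f' = 0 := fun k _ => by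
    apply Subtype.ext
    rw [Submodule.coe_smul, commOp_smul]
    simp [f', hf.central]
  have hwf' : tensorOverMul _ _ A' (w • v) = f := by
    rw [map_smul, tensorOverMul_mk, hf.idem, hwf]
  -- Multiplication takes values in the whole algebra, so the retraction composes it with h ↦ h f to
  -- land in the block.
  refine isIsoToDirectSummand_of_retraction
    ((toBimodule (w • v) (commOp_smul_smul_eq_zero hw hv)).comp (blockBimodule F f).subtype)
    ((toBimodule f' hcf).comp (tensorOverMul _ _ A')) fun b => Subtype.ext ?_
  rw [LinearMap.comp_apply, LinearMap.comp_apply, toBimodule_apply, toBimodule_apply, map_smul,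
    hwf', Submodule.coe_smul, ← MulOpposite.op_one, env_tmul_smul, env_tmul_smul, mul_one, mul_one,
    Submodule.subtype_apply, hf.mul_of_mem b.2, hf.mul_of_mem b.2]

theorem isRelativelyProjectiveBimodule_block {S : Set ℕ} {A' : Subalgebra F (HeckeAlgebra F q n)}
    (hA' : ∀ k ∈ S, genSeq q n k ∈ A') {f : HeckeAlgebra F q n} (hf : IsBlockIdempotent f)
    {w : Env F (HeckeAlgebra F q n)}
    (hw : ∀ k, k + 1 < n → commOp F (genSeq q n) k * w ∈
      Ideal.span (commOp F (genSeq q n) '' S)) (hwf : w • f = f) :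
    IsRelativelyProjectiveBimodule A' A' (blockBimodule F f) := by
  refine isRelativelyProjectiveBimodule_of_operator hA' (blockBimodule F f).subtype
    ⟨f, Submodule.mem_span_singleton_self f⟩ (fun m => Subtype.ext ?_) (fun k => Subtype.ext ?_) hw
    (Subtype.ext hwf)
  · rw [Submodule.coe_smul, ← MulOpposite.op_one, env_tmul_smul, mul_one]
    exact hf.mul_of_mem m.2
  · rw [Submodule.coe_smul, commOp_smul, hf.central, sub_self]
    rfl

/-! ## The sign character -/

variable (q n) in
theorem isHeckeSeq_sign :
    IsHeckeSeq q n (fun k => if k + 1 < n then (-1 : F) else 0) where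
  comm i j _ := Commute.all _ _
  braid k := by split_ifs <;> first | omega | simp
  quadratic k hk := by simp [hk]
  eq_zero k hk := if_neg (by omega)

variable (q n) in
/-- The sign character `T_i ↦ -1`. -/
def signChar : HeckeAlgebra F q n →ₐ[F] F :=
  lift (isHeckeSeq_sign q n) 0 n (by omega)

theorem signChar_genSeq {k : ℕ} (hk : k + 1 < n) : signChar q n (genSeq q n k) = -1 := by
  rw [signChar, lift_genSeq _ _ _ _ hk]
  simp [hk]

theorem signChar_gen (i : Fin (n - 1)) : signChar q n (gen q i) = -1 := by
  rw [← signChar_genSeq (q := q) (n := n) (k := i) (by omega), genSeq_of_lt i.2]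

/-- Any word with product w has length of the parity of w, so reducedness plays no role. -/
theorem signChar_T (w : Equiv.Perm (Fin n)) :
    signChar q n (T q w) = ((Equiv.Perm.sign w : ℤ) : F) := by
  obtain ⟨h1, -⟩ := (exists_reducedWord w).choose_spec
  rw [T]
  conv_rhs => rw [← h1]
  generalize (exists_reducedWord w).choose = l
  clear h1
  induction l with
  | nil => simp
  | cons i l ih =>
    rw [List.map_cons, List.map_cons, List.prod_cons, List.prod_cons, map_mul, map_mul, ih,
      signChar_gen, simpleTransposition, Equiv.Perm.sign_swap (by simp)]
    simp

/-- A part of size at least 2 puts a transposition into the parabolic subgroup, and multiplication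
by it pairs off terms of opposite sign. -/
theorem signChar_murphyElement {nu : Composition n} (h : nu ≠ Composition.ones n) :
    signChar q n (murphyElement q nu) = 0 := by
  classical
  obtain ⟨b, hb, hb1⟩ := Composition.ne_ones_iff.1 h
  obtain ⟨i, hi, rfl⟩ := List.getElem_of_mem hb
  let x := nu.embedding ⟨i, hi⟩ ⟨0, by change 0 < nu.blocks[i]; omega⟩
  let y := nu.embedding ⟨i, hi⟩ ⟨1, by change 1 < nu.blocks[i]; omega⟩
  have hxy : x ≠ y := fun h => by
    have := (nu.embedding ⟨i, hi⟩).injective h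
    simp at this
  have hidx : nu.index x = nu.index y := by rw [nu.index_embedding, nu.index_embedding]
  have hs : Equiv.swap x y ∈ parabolicSubgroup nu := by
    intro j
    rw [Equiv.swap_apply_def]
    split_ifs with h1 h2
    · rw [h1, hidx]
    · rw [h2, hidx]
    · rfl
  rw [murphyElement, map_sum]
  refine Finset.sum_involution (fun w _ => Equiv.swap x y * w) (fun w _ => ?_) (fun w _ _ hw => ?_)
    (fun w hw => ?_) (fun w _ => ?_)
  · rw [signChar_T, signChar_T, map_mul, Equiv.Perm.sign_swap hxy]
    simp
  · exact hxy (Equiv.swap_eq_one_iff.1 (mul_eq_right.1 hw))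
  · rw [Finset.mem_filter] at hw ⊢
    exact ⟨Finset.mem_univ _, mul_mem hs hw.2⟩
  · rw [← mul_assoc, Equiv.swap_mul_self, one_mul]

theorem signChar_murphyElement_ones :
    signChar q n (murphyElement q (Composition.ones n)) = 1 := by
  classical
  have hidx : Function.Injective (Composition.ones n).index := by
    have : ∀ j : Fin n, ((Composition.ones n).index j : ℕ) = j := fun j => by
      have h1 := (Composition.ones n).sizeUpTo_index_le j
      have h2 := (Composition.ones n).lt_sizeUpTo_index_succ j
      simp only [Composition.ones_sizeUpTo, Fin.val_succ] at h1 h2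
      omega
    intro i j hij
    exact Fin.ext (by rw [← this i, ← this j, hij])
  have : (Finset.univ.filter fun w : Equiv.Perm (Fin n) =>
      w ∈ parabolicSubgroup (Composition.ones n)) = {1} := by
    ext w
    rw [Finset.mem_filter, Finset.mem_singleton]
    constructor
    · rintro ⟨-, hw⟩
      exact Equiv.ext fun i => hidx (hw i)
    · rintro rfl
      exact ⟨Finset.mem_univ _, one_mem _⟩
  rw [murphyElement, this, Finset.sum_singleton, signChar_T]
  simp

/-- The sign character thus descends to the quotient in which the Specht module of the column is
defined, where it can detect the generator. -/
theorem signChar_dominatingIdeal {x : HeckeAlgebra F q n}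
    (hx : x ∈ dominatingIdeal q (Composition.ones n)) : signChar q n x = 0 := by
  induction hx using Submodule.span_induction with
  | mem x hx =>
    obtain ⟨nu, -, hnu, a, rfl⟩ := hx
    rw [map_mul, signChar_murphyElement hnu.1, mul_zero]
  | zero => exact map_zero _
  | add x y _ _ hx hy => rw [map_add, hx, hy, add_zero]
  | smul c x _ hx => rw [← MulOpposite.op_unop c, op_smul_eq_mul, map_mul, hx, zero_mul]

end HeckeAlgebra

/-! ## The column has empty core -/

theorem sortedGE_blocks_ones (n : ℕ) : (Composition.ones n).blocks.SortedGE := by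
  rw [Composition.ones_blocks]
  exact List.pairwise_replicate_of_refl.sortedGE

theorem mem_partitionDiagram_ones {n : ℕ} {x : ℕ × ℕ} :
    x ∈ partitionDiagram (Composition.ones n) (sortedGE_blocks_ones n) ↔ x.1 < n ∧ x.2 = 0 := by
  rw [partitionDiagram, YoungDiagram.mem_ofRowLens]
  simp [Composition.ones]

/-- Vertical strips of e boxes come off the bottom of the column one by one. Positivity of e ensures
that no hook can be removed from the empty diagram. -/
theorem isCoreOf_ones {e : ℕ} (he : 0 < e) (d : ℕ) :
    IsCoreOf e (partitionDiagram (Composition.ones (d * e)) (sortedGE_blocks_ones (d * e))) ⊥ := by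
  constructor
  · induction d with
    | zero =>
      have : partitionDiagram (Composition.ones (0 * e)) (sortedGE_blocks_ones (0 * e)) = ⊥ := by
        ext x
        have := mem_partitionDiagram_ones (n := 0 * e) (x := x)
        rw [YoungDiagram.mem_cells, this]
        simp
      rw [this]
    | succ d ih =>
      refine Relation.ReflTransGen.head ⟨fun x hx => ?_, ?_⟩ ih
      · rw [mem_partitionDiagram_ones] at *
        exact ⟨hx.1.trans_le (Nat.mul_le_mul_right e d.le_succ), hx.2⟩
      · refine ⟨(List.range e).map fun i => (d * e + i, 0), by simp, ?_, fun x => ?_⟩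
        · rw [List.isChain_map]
          refine (List.isChain_range _ _).2 fun i hi => ?_
          exact Or.inl rfl
        · rw [mem_partitionDiagram_ones, mem_partitionDiagram_ones, List.mem_map, Nat.succ_mul]
          constructor
          · rintro ⟨i, hi, rfl⟩
            rw [List.mem_range] at hi
            exact ⟨⟨by simp only []; omega, rfl⟩, by simp only []; omega⟩
          · rintro ⟨⟨h1, h2⟩, h3⟩
            refine ⟨x.1 - d * e, List.mem_range.2 (by omega), ?_⟩
            have : d * e ≤ x.1 := by
              by_contra h
              exact h3 ⟨by omega, h2⟩
            exact Prod.ext (by simp only []; omega) h2.symm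
  · rintro sig ⟨-, l, hl, -, hmem⟩
    obtain ⟨x, hx⟩ : ∃ x, x ∈ l := List.exists_mem_of_length_pos (by omega)
    exact absurd ((hmem x).1 hx).1 (by simp)

/-- Since f fixes the generator of the Specht module of the column, m f - m lies in the dominating
ideal for m = m_{(1^{de})}. The sign character kills that ideal and takes the value 1 at m. -/
theorem HeckeAlgebra.signChar_of_isEmptyCoreBlockIdempotent {F : Type u} [Field F] {q : F} {e d : ℕ}
    (he : 0 < e) {f : HeckeAlgebra F q (d * e)} (hf : IsEmptyCoreBlockIdempotent q e f) :
    signChar q (d * e) f = 1 := by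
  have h1 := hf.specht (Composition.ones (d * e)) (sortedGE_blocks_ones _) (isCoreOf_ones he d) _
    (Submodule.mem_span_singleton_self _)
  rw [← map_smul, ← sub_eq_zero, ← map_sub, Submodule.mkQ_apply, Submodule.Quotient.mk_eq_zero]
    at h1
  have h2 := signChar_dominatingIdeal h1
  rw [op_smul_eq_mul, map_sub, map_mul, signChar_murphyElement_ones, one_mul,
    sub_eq_zero] at h2
  exact h2

/-! ## Iterated relative traces -/

section ProdTrace

variable {E : Type*} [Ring E]

/-- The relative trace from `S_s × S_{b_1} × S_{b_2} × ⋯` to `S_{s + b_1 + b_2 + ⋯}`. -/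
def prodTrace (σ : ℕ → E) : ℕ → List ℕ → E
  | _, [] => 1
  | s, b :: l => prodTrace σ (s + b) l * relTrace σ s b

@[simp] theorem prodTrace_nil (σ : ℕ → E) (s : ℕ) : prodTrace σ s [] = 1 := rfl

theorem prodTrace_cons (σ : ℕ → E) (s b : ℕ) (l : List ℕ) :
    prodTrace σ s (b :: l) = prodTrace σ (s + b) l * relTrace σ s b := rfl

theorem prodTrace_append (σ : ℕ → E) (s : ℕ) (l l' : List ℕ) :
    prodTrace σ s (l ++ l') = prodTrace σ (s + l.sum) l' * prodTrace σ s l := by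
  induction l generalizing s with
  | nil => simp
  | cons b l ih =>
    rw [List.cons_append, prodTrace_cons, prodTrace_cons, ih, List.sum_cons, mul_assoc, add_assoc]

theorem prodTrace_congr {σ τ : ℕ → E} {s : ℕ} {l : List ℕ} (h : ∀ k, k + 1 < s + l.sum → σ k = τ k) :
    prodTrace σ s l = prodTrace τ s l := by
  induction l generalizing s with
  | nil => rfl
  | cons b l ih =>
    rw [List.sum_cons] at h
    rw [prodTrace_cons, prodTrace_cons, ih fun k hk => h k (by omega),
      relTrace_congr fun k hk => h k (by omega)]

theorem map_prodTrace {E' : Type*} [Ring E'] (f : E →+* E') (σ : ℕ → E) (s : ℕ) (l : List ℕ) :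
    f (prodTrace σ s l) = prodTrace (fun k => f (σ k)) s l := by
  induction l generalizing s with
  | nil => simp
  | cons b l ih => rw [prodTrace_cons, prodTrace_cons, map_mul, ih, map_relTrace]

/-- Invariants under a parabolic subgroup are sent by the iterated relative trace to invariants. -/
theorem IsTransferSeq.delta_mul_prodTrace {σ δ : ℕ → E} (h : IsTransferSeq σ δ) {s k : ℕ}
    {l : List ℕ} (hk : k + 1 < s + l.sum) :
    δ k * prodTrace σ s l ∈
      Ideal.span (δ '' {j | j + 1 < s + l.sum ∧ ∀ i, s + (l.take i).sum ≠ j + 1}) := by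
  induction l generalizing s k with
  | nil =>
    rw [List.sum_nil, add_zero] at *
    rw [prodTrace_nil, mul_one]
    exact Ideal.subset_span ⟨k, ⟨hk, fun i => by rw [List.take_nil, List.sum_nil]; omega⟩, rfl⟩
  | cons b l ih =>
    rw [List.sum_cons, ← add_assoc] at *
    have hk2 := ih hk
    rw [prodTrace_cons, ← mul_assoc]
    generalize δ k * prodTrace σ (s + b) l = z at hk2
    induction hk2 using Submodule.span_induction with
    | mem x hx =>
      obtain ⟨j, ⟨hj1, hj2⟩, rfl⟩ := hx
      rcases Nat.lt_or_ge (j + 1) (s + b) with hj | hj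
      · refine Ideal.span_mono (Set.image_mono fun m hm => ?_) (h.delta_mul_relTrace hj)
        refine ⟨hm.1.trans_le (Nat.le_add_right _ _), fun i => ?_⟩
        rcases i with _ | i
        · simpa using hm.2.symm
        · rw [List.take_succ_cons, List.sum_cons]
          have := hm.1
          omega
      · have hj3 := hj2 0
        rw [List.take_zero, List.sum_nil, add_zero] at hj3
        rw [(commute_relTrace fun i hi => h.comm_delta j i (by omega)).eq]
        refine Ideal.mul_mem_left _ _ (Ideal.subset_span ⟨j, ⟨hj1, fun i => ?_⟩, rfl⟩)
        rcases i with _ | i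
        · rw [List.take_zero, List.sum_nil]
          omega
        · rw [List.take_succ_cons, List.sum_cons, ← add_assoc]
          exact hj2 i
    | zero => rw [zero_mul]; exact zero_mem _
    | add x y _ _ hx hy => rw [add_mul]; exact add_mem hx hy
    | smul c x _ hx => rw [smul_eq_mul, mul_assoc]; exact Ideal.mul_mem_left _ _ hx

end ProdTrace

/-! ## Gaussian binomial coefficients -/

section Gaussian

open Polynomial

variable {F : Type*} [Field F] {x : F} {e : ℕ}

theorem descProd_const (x : F) (a l : ℕ) : descProd (fun _ => x) a l = x ^ l := by
  induction l with
  | zero => simp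
  | succ l ih => rw [descProd_succ, ih, pow_succ']

/-- Splitting off the factor i = 0 instead of the last one gives the functional equation behind both
the q-binomial theorem and the evaluation at a root of unity. -/
theorem prod_one_add_succ (x : F) (n : ℕ) :
    ∏ i ∈ Finset.range (n + 1), (1 + C (x ^ i) * X) =
      (1 + X) * (∏ i ∈ Finset.range n, (1 + C (x ^ i) * X)).comp (C x * X) := by
  rw [Finset.prod_range_succ', mul_comm, Polynomial.prod_comp]
  simp [pow_succ, mul_assoc]

/-- The `q`-binomial theorem. -/
theorem coeff_prod_one_add (x : F) : ∀ a b : ℕ,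
    (∏ i ∈ Finset.range (a + b), (1 + C (x ^ i) * X)).coeff b =
      x ^ (b.choose 2) * relTrace (fun _ => x) a b
  | a, 0 => by
    rw [relTrace_zero_right, coeff_zero_prod]
    simp
  | 0, b + 1 => by
    have h := coeff_prod_one_add x 0 b
    have h0 : (∏ i ∈ Finset.range b, (1 + C (x ^ i) * X)).coeff (b + 1) = 0 := by
      refine coeff_eq_zero_of_natDegree_lt (Nat.lt_succ_of_le ((natDegree_prod_le _ _).trans ?_))
      refine (Finset.sum_le_card_nsmul _ _ 1 fun i _ => ?_).trans (by simp)
      compute_degree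
    rw [zero_add, relTrace_zero_left, mul_one] at *
    rw [prod_one_add_succ, add_mul, one_mul, coeff_add, coeff_X_mul, comp_C_mul_X_coeff,
      comp_C_mul_X_coeff, h0, h, Nat.choose_succ_succ' b 1, pow_add, Nat.choose_one_right]
    ring
  | a + 1, b + 1 => by
    have h1 := coeff_prod_one_add x a (b + 1)
    have h2 := coeff_prod_one_add x (a + 1) b
    rw [show a + 1 + b = a + (b + 1) by omega] at h2
    rw [show a + 1 + (b + 1) = a + (b + 1) + 1 by omega,
      prod_one_add_succ, add_mul, one_mul, coeff_add, coeff_X_mul, comp_C_mul_X_coeff,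
      comp_C_mul_X_coeff, h1, h2, relTrace_succ_succ, descProd_const, Nat.choose_succ_succ' b 1,
      pow_add, Nat.choose_one_right]
    ring

theorem prod_one_add_mul (hx : x ^ e = 1) (m : ℕ) :
    ∏ i ∈ Finset.range (e * m), (1 + C (x ^ i) * X) =
      (∏ i ∈ Finset.range e, (1 + C (x ^ i) * X)) ^ m := by
  induction m with
  | zero => simp
  | succ m ih =>
    rw [Nat.mul_succ, Finset.prod_range_add, ih, pow_succ]
    simp [pow_add, pow_mul, hx]

theorem coeff_one_add_C_mul_X_pow (u : F) (m b : ℕ) (he : 0 < e) :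
    ((1 + C u * X ^ e : F[X]) ^ m).coeff (e * b) = u ^ b * (m.choose b : F) := by
  have h : (1 + C u * X ^ e : F[X]) ^ m = expand F e (((1 + X) ^ m : F[X]).comp (C u * X)) := by
    simp
  rw [h, mul_comm e, coeff_expand_mul he, comp_C_mul_X_coeff, coeff_one_add_X_pow, mul_comm]

/-- `x` is a primitive `e`-th root of unity, or `x = 1` and `e` is the characteristic. -/
def IsQuantumRoot (x : F) (e : ℕ) : Prop :=
  IsPrimitiveRoot x e ∨ x = 1 ∧ e.Prime ∧ CharP F e

theorem IsQuantumRoot.pow_eq_one (h : IsQuantumRoot x e) : x ^ e = 1 := by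
  rcases h with h | ⟨rfl, -⟩
  · exact h.pow_eq_one
  · exact one_pow e

/-- For a primitive root the product is invariant under X ↦ x X, so only the coefficients in degrees
0 and e survive. For x = 1 in characteristic e this is the Frobenius identity. -/
theorem IsQuantumRoot.prod_one_add (he : 0 < e) (h : IsQuantumRoot x e) :
    ∃ u : F, u ≠ 0 ∧ ∏ i ∈ Finset.range e, (1 + C (x ^ i) * X) = 1 + C u * X ^ e := by
  have hx0 : x ≠ 0 := by
    rintro rfl
    exact zero_ne_one ((zero_pow he.ne').symm.trans h.pow_eq_one)
  rcases h with h | ⟨rfl, hp, _⟩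
  · refine ⟨x ^ (e.choose 2), pow_ne_zero _ hx0, ?_⟩
    -- The product over e + 1 factors is split in two ways. Its last factor equals its first, 1 + X,
    -- because x^e = 1.
    have h1 : (∏ i ∈ Finset.range e, (1 + C (x ^ i) * X)).comp (C x * X) =
        ∏ i ∈ Finset.range e, (1 + C (x ^ i) * X) := by
      have h2 := prod_one_add_succ x e
      rw [Finset.prod_range_succ, h.pow_eq_one, C_1, one_mul, mul_comm] at h2
      have h3 : (1 + X : F[X]) ≠ 0 := fun h => by simpa using congr_arg (coeff · 0) h
      exact (mul_left_cancel₀ h3 h2).symm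
    ext j
    rw [coeff_add, coeff_C_mul, coeff_X_pow, coeff_one]
    rcases lt_trichotomy j e with hj | rfl | hj
    · rcases Nat.eq_zero_or_pos j with rfl | hj0
      · have := coeff_prod_one_add x e 0
        rw [add_zero] at this
        rw [this]
        simp [he.ne]
      · have h4 := congr_arg (coeff · j) h1
        simp only [comp_C_mul_X_coeff] at h4
        rw [if_neg hj0.ne', if_neg hj.ne, mul_zero, add_zero]
        by_contra h5
        exact h.pow_ne_one_of_pos_of_lt hj0.ne' hj (mul_left_cancel₀ h5 (h4.trans (mul_one _).symm))
    · have := coeff_prod_one_add x 0 j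
      rw [zero_add] at this
      rw [this]
      simp [he.ne']
    · rw [if_neg (by omega), if_neg (by omega), mul_zero, add_zero]
      refine coeff_eq_zero_of_natDegree_lt (lt_of_le_of_lt (natDegree_prod_le _ _) ?_)
      refine lt_of_le_of_lt ((Finset.sum_le_card_nsmul _ _ 1 fun i _ => ?_).trans (by simp)) hj
      compute_degree
  · refine ⟨1, one_ne_zero, ?_⟩
    have : Fact e.Prime := ⟨hp⟩
    simp [add_pow_char]

/-- This is the q-Lucas congruence: the product over e (a + b) factors is (1 + u X^e)^(a+b), so up
to nonzero factors the Gaussian binomial is the ordinary binomial coefficient. -/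
theorem IsQuantumRoot.relTrace_ne_zero (he : 0 < e) (h : IsQuantumRoot x e) {a b : ℕ}
    (hab : ((a + b).choose b : F) ≠ 0) : relTrace (fun _ => x) (e * a) (e * b) ≠ 0 := by
  obtain ⟨u, hu, hprod⟩ := h.prod_one_add he
  intro h0
  have h1 := coeff_prod_one_add x (e * a) (e * b)
  rw [← mul_add, prod_one_add_mul h.pow_eq_one, hprod, coeff_one_add_C_mul_X_pow _ _ _ he, h0,
    mul_zero] at h1
  exact mul_ne_zero (pow_ne_zero _ hu) hab h1

theorem IsQuantumRoot.prodTrace_replicate_ne_zero (he : 0 < e) (h : IsQuantumRoot x e) {c m s : ℕ}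
    (hc : ∀ j < m, ((s + (j + 1) * c).choose c : F) ≠ 0) :
    prodTrace (fun _ => x) (e * s) (List.replicate m (e * c)) ≠ 0 := by
  induction m generalizing s with
  | zero => simp
  | succ m ih =>
    rw [List.replicate_succ, prodTrace_cons, ← mul_add]
    refine mul_ne_zero (ih fun j hj => ?_) (h.relTrace_ne_zero he ?_)
    · have := hc (j + 1) (by omega)
      rwa [add_mul (j + 1), one_mul, add_comm _ c, ← add_assoc] at this
    · simpa using hc 0 (by omega)

/-- Lucas' theorem, stripping one base-p digit at a time: the lowest digit of p^(i+1) is 0 and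
contributes a factor 1. -/
theorem choose_add_mul_pow_modEq {p : ℕ} [Fact p.Prime] {i s j : ℕ} (hs : s < p ^ i) :
    (s + j * p ^ i).choose (p ^ i) ≡ j [MOD p] := by
  induction i generalizing s with
  | zero =>
    obtain rfl : s = 0 := by simpa using hs
    simp [Nat.ModEq.refl]
  | succ i ih =>
    have hp : 0 < p := (Fact.out : p.Prime).pos
    have h1 := Choose.choose_modEq_choose_mod_mul_choose_div_nat (p := p)
      (n := s + j * p ^ (i + 1)) (k := p ^ (i + 1))
    have h2 : p ^ (i + 1) % p = 0 := by rw [pow_succ, Nat.mul_mod_left]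
    have h3 : p ^ (i + 1) / p = p ^ i := by rw [pow_succ, Nat.mul_div_cancel _ hp]
    have h4 : (s + j * p ^ (i + 1)) / p = s / p + j * p ^ i := by
      rw [pow_succ, ← mul_assoc, Nat.add_mul_div_right _ _ hp]
    rw [h2, h3, h4, Nat.choose_zero_right, one_mul] at h1
    exact h1.trans (ih (Nat.div_lt_of_lt_mul (by rwa [pow_succ'] at hs)))

/-- Here s collects the lower digits, so s < p^i. Adjoining a copies of p^i contributes binomials
congruent to 1, …, a modulo p, all nonzero because the digit a is below p. -/
theorem IsQuantumRoot.prodTrace_digits_ne_zero (he : 0 < e) (h : IsQuantumRoot x e) {p : ℕ}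
    [CharP F p] [hp : Fact p.Prime] {i s : ℕ} (hs : s < p ^ i) {l : List ℕ} (hl : ∀ a ∈ l, a < p) :
    prodTrace (fun _ => x) (e * s)
      (l.mapIdx fun k a => List.replicate a (e * p ^ (i + k))).flatten ≠ 0 := by
  induction l generalizing i s with
  | nil => simp
  | cons a l ih =>
    have hap := hl a List.mem_cons_self
    have hshift : (l.mapIdx fun k a => List.replicate a (e * p ^ (i + (k + 1)))) =
        l.mapIdx fun k a => List.replicate a (e * p ^ (i + 1 + k)) := by
      congr 1; funext k a; congr 3; omega
    rw [List.mapIdx_cons, List.flatten_cons, prodTrace_append, hshift, List.sum_replicate,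
      smul_eq_mul, add_zero, mul_left_comm, ← mul_add]
    refine mul_ne_zero (ih ?_ fun b hb => hl b (List.mem_cons_of_mem _ hb))
      (h.prodTrace_replicate_ne_zero he fun j hj => ?_)
    · calc s + a * p ^ i < (a + 1) * p ^ i := by rw [add_mul, one_mul]; omega
        _ ≤ p * p ^ i := Nat.mul_le_mul_right _ hap
        _ = p ^ (i + 1) := (pow_succ' _ _).symm
    · rw [Ne, CharP.cast_eq_zero_iff F p, (choose_add_mul_pow_modEq hs).dvd_iff dvd_rfl]
      exact Nat.not_dvd_of_pos_of_lt (by omega) (by omega)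

theorem IsQuantumRoot.prodTrace_stdMaxParts_ne_zero (he : 0 < e) (h : IsQuantumRoot x e) (p : ℕ)
    [CharP F p] (d : ℕ) : prodTrace (fun _ => x) 0 (stdMaxParts e p (d * e)) ≠ 0 := by
  rw [stdMaxParts, Nat.mul_mod_left, Nat.mul_div_cancel _ he, List.replicate_zero,
    List.nil_append]
  split_ifs with hp
  · subst hp
    have : CharZero F := CharP.charP_to_charZero F
    have := h.prodTrace_replicate_ne_zero he (c := 1) (m := d) (s := 0) fun j _ => by
      simpa using Nat.cast_add_one_ne_zero (R := F) j
    simpa using this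
  · have hpp : Fact p.Prime := ⟨(CharP.char_is_prime_or_zero F p).resolve_right hp⟩
    have := h.prodTrace_digits_ne_zero he (p := p) (i := 0) (s := 0) (l := p.digits d) (by simp)
      fun a ha => Nat.digits_lt_base hpp.out.one_lt ha
    simpa using this

theorem IsQuantumRoot.inv (h : IsQuantumRoot x e) : IsQuantumRoot x⁻¹ e := by
  rcases h with h | ⟨rfl, h⟩
  · exact Or.inl h.inv
  · exact Or.inr ⟨inv_one, h⟩

end Gaussian

/-- If q = 1 the geometric sum is k itself, so e is the characteristic. Otherwise the sum vanishes
exactly when q^k = 1. -/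
theorem isQuantumRoot_of_quantumChar {F : Type u} [Field F] (p : ℕ) [CharP F p] {q : F} {e : ℕ}
    (hqe : quantumChar q = e) (he : 1 < e) :
    IsPrimitiveRoot q e ∨ q = 1 ∧ e.Prime ∧ e = p := by
  have hne : {k : ℕ | 0 < k ∧ ∑ i ∈ Finset.range k, q ^ i = 0}.Nonempty := by
    by_contra h
    rw [quantumChar, Set.not_nonempty_iff_eq_empty.1 h, Nat.sInf_empty] at hqe
    omega
  have hmem := Nat.sInf_mem hne
  have hmin : ∀ k, 0 < k → ∑ i ∈ Finset.range k, q ^ i = 0 → e ≤ k := fun k h0 hk => by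
    rw [← hqe]
    exact Nat.sInf_le ⟨h0, hk⟩
  rw [← quantumChar, hqe] at hmem
  obtain ⟨h0, hsum⟩ := hmem
  by_cases hq1 : q = 1
  · subst hq1
    simp only [one_pow, Finset.sum_const, Finset.card_range, nsmul_eq_mul, mul_one] at hsum hmin
    have hdvd := (CharP.cast_eq_zero_iff F p e).1 hsum
    have hp0 : 0 < p := Nat.pos_of_dvd_of_pos hdvd h0
    obtain rfl : e = p := le_antisymm (hmin p hp0 (CharP.cast_eq_zero F p)) (Nat.le_of_dvd h0 hdvd)
    exact Or.inr ⟨rfl, (CharP.char_is_prime_or_zero F e).resolve_right hp0.ne', rfl⟩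
  · have hgeom : ∀ k, ∑ i ∈ Finset.range k, q ^ i = 0 ↔ q ^ k = 1 := fun k => by
      rw [← sub_eq_zero (a := q ^ k), ← geom_sum_mul, mul_eq_zero, or_iff_left (sub_ne_zero.2 hq1)]
    refine Or.inl (IsPrimitiveRoot.mk_of_lt q h0 ((hgeom e).1 hsum) fun k hk hke h1 => ?_)
    exact absurd (hmin k hk ((hgeom k).2 h1)) (by omega)

theorem env_smul_mul_left_of_central {F A : Type u} [Field F] [Ring A] [Algebra F A] {z : A}
    (hz : ∀ a, z * a = a * z) (w : Env F A) (x : A) : w • (z * x) = z * w • x := by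
  refine env_smul_mul_left ?_ x
  induction w using TensorProduct.induction_on with
  | zero => exact Commute.zero_right _
  | add v w hv hw => exact hv.add_right hw
  | tmul a b =>
    simp only [Commute, SemiconjBy, Algebra.TensorProduct.tmul_mul_tmul, hz, one_mul, mul_one]

/-! ### The sign of the iterated trace, and the normalised operator on the block. -/

namespace HeckeAlgebra

variable {F : Type u} [Field F] {q : F} {n : ℕ}

variable (q n) in
/-- The character of the enveloping algebra given by the sign character on both sides. -/
def signCharEnv : Env F (HeckeAlgebra F q n) →ₐ[F] F :=
  Algebra.TensorProduct.lift (signChar q n)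
    ((signChar q n).fromOpposite fun _ _ => Commute.all _ _) fun _ _ => Commute.all _ _

theorem signCharEnv_tmul (a b : HeckeAlgebra F q n) :
    signCharEnv q n (a ⊗ₜ[F] MulOpposite.op b) = signChar q n a * signChar q n b := by
  rw [signCharEnv, Algebra.TensorProduct.lift_tmul]
  rfl

theorem signChar_smul (w : Env F (HeckeAlgebra F q n)) (x : HeckeAlgebra F q n) :
    signChar q n (w • x) = signCharEnv q n w * signChar q n x := by
  induction w using TensorProduct.induction_on with
  | zero => rw [env_zero_smul, map_zero, map_zero, zero_mul]
  | add v w hv hw => rw [add_smul, map_add, map_add, add_mul, hv, hw]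
  | tmul a b =>
    obtain ⟨b, rfl⟩ := MulOpposite.op_surjective b
    rw [env_tmul_smul, signCharEnv_tmul, map_mul, map_mul]
    ring

/-- The two signs cancel, which turns relative traces into Gaussian binomials at q⁻¹ rather than at
q. -/
theorem signCharEnv_conjOp {k : ℕ} (hk : k + 1 < n) :
    signCharEnv q n (conjOp q (genSeq q n) k) = q⁻¹ := by
  rw [conjOp, map_smul, signCharEnv_tmul, signChar_genSeq hk]
  simp

theorem genSeq_mem_of_sizeUpTo (c : Composition n) :
    ∀ k ∈ {j | j + 1 < n ∧ ∀ i, c.sizeUpTo i ≠ j + 1}, genSeq q n k ∈ parabolicSubalgebra q c :=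
  fun _ hk => genSeq_mem_parabolicSubalgebra c hk.2

theorem commOp_mul_prodTrace (hq : q ≠ 0) (c : Composition n) {k : ℕ} (hk : k + 1 < n) :
    commOp F (genSeq q n) k * prodTrace (conjOp q (genSeq q n)) 0 c.blocks ∈
      Ideal.span (commOp F (genSeq q n) '' {j | j + 1 < n ∧ ∀ i, c.sizeUpTo i ≠ j + 1}) := by
  have h := ((isHeckeSeq_genSeq q n).isTransferSeq hq).delta_mul_prodTrace (s := 0) (k := k)
    (l := c.blocks) (by rwa [c.blocks_sum, zero_add])
  simpa only [c.blocks_sum, zero_add, Composition.sizeUpTo] using h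

/-- If the relative trace from a parabolic subalgebra is not killed by the sign character, then it
can be normalized to an operator that fixes the block idempotent of the sign character. -/
theorem exists_operator (hq : q ≠ 0) (c : Composition n)
    (hc : prodTrace (fun _ => q⁻¹) 0 c.blocks ≠ 0) {f : HeckeAlgebra F q n}
    (hf : IsBlockIdempotent f) (hεf : signChar q n f = 1) :
    ∃ w : Env F (HeckeAlgebra F q n), (∀ k, k + 1 < n → commOp F (genSeq q n) k * w ∈
      Ideal.span (commOp F (genSeq q n) '' {j | j + 1 < n ∧ ∀ i, c.sizeUpTo i ≠ j + 1})) ∧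
      w • f = f := by
  set t := prodTrace (conjOp q (genSeq q n)) 0 c.blocks with ht
  have hψ : signCharEnv q n t = prodTrace (fun _ => q⁻¹) 0 c.blocks := by
    rw [ht]
    refine (map_prodTrace (signCharEnv q n).toRingHom _ _ _).trans (prodTrace_congr fun k hk => ?_)
    rw [c.blocks_sum, zero_add] at hk
    exact signCharEnv_conjOp hk
  have hcz : t • (1 : HeckeAlgebra F q n) ∈ Subalgebra.center F (HeckeAlgebra F q n) := by
    refine Subalgebra.mem_center_iff.2 fun a =>
      (commute_of_commute_genSeq (fun k hk => ?_) a).eq.symm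
    rw [← commOp_smul_eq_zero_iff (F := F), smul_smul]
    exact smul_eq_zero_of_mem_span_commOp (commOp_mul_prodTrace hq c hk)
      fun j _ => commOp_smul_eq_zero_iff.2 (Commute.one_left _)
  obtain ⟨c', hc', hcf⟩ := hf.exists_inverse (signChar q n) hεf hcz (by
    rw [signChar_smul, map_one, mul_one, hψ]
    exact hc)
  -- Left multiplication by the central inverse c' commutes with every commutator operator, so it
  -- normalises t without affecting the transfer property.
  refine ⟨(c' ⊗ₜ[F] 1) * t, fun k hk => ?_, ?_⟩
  · have hck : Commute c' (genSeq q n k) := (Subalgebra.mem_center_iff.1 hc' _).symm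
    rw [← mul_assoc, ← (commute_tmul_one_commOp hck).eq, mul_assoc]
    exact Ideal.mul_mem_left _ _ (commOp_mul_prodTrace hq c hk)
  · have h1 : t • f = f * t • (1 : HeckeAlgebra F q n) := by
      rw [← env_smul_mul_left_of_central hf.central, mul_one]
    rw [mul_smul, h1, hf.central, ← MulOpposite.op_one, env_tmul_smul, mul_one, ← mul_assoc, hcf,
      hf.idem]

end HeckeAlgebra

end

theorem mainTheorem8 {F : Type u} [Field F] [IsAlgClosed F] (p : ℕ) [CharP F p]
    (q : F) (hq : q ≠ 0) (e : ℕ) (hqe : quantumChar q = e) (he : 1 < e) (d : ℕ) :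
    (∀ f : HeckeAlgebra F q (d * e), IsEmptyCoreBlockIdempotent q e f →
      IsIsoToDirectSummand (Env F (HeckeAlgebra F q (d * e)))
        (blockBimodule F f)
        (TensorOver F (HeckeAlgebra F q (d * e)) (blockBimodule F f) (blockBimodule F f)
          (parabolicSubalgebra q (stdMaxComposition e p (d * e) (by omega)))) ∧
      IsRelativelyProjectiveBimodule
        (parabolicSubalgebra q (stdMaxComposition e p (d * e) (by omega)))
        (parabolicSubalgebra q (stdMaxComposition e p (d * e) (by omega)))
        (blockBimodule F f)) ∧
    (p = 0 →
      IsRelativelyProjectiveBimodule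
        (parabolicSubalgebra q (rectComposition d e (by omega)))
        (parabolicSubalgebra q (rectComposition d e (by omega)))
        (HeckeAlgebra F q (d * e))) := by
  have hroot := isQuantumRoot_of_quantumChar p hqe he
  refine ⟨fun f hf => ?_, fun hp => ?_⟩
  -- The root condition is needed at q⁻¹, the scalar by which the sign character evaluates the
  -- conjugation operators.
  · have hqr : IsQuantumRoot q⁻¹ e := by
      refine IsQuantumRoot.inv ?_
      rcases hroot with h | ⟨h1, h2, rfl⟩
      · exact Or.inl h
      · exact Or.inr ⟨h1, h2, inferInstance⟩
    obtain ⟨w, hw, hwf⟩ := HeckeAlgebra.exists_operator hq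
      (stdMaxComposition e p (d * e) (by omega))
      (hqr.prodTrace_stdMaxParts_ne_zero (by omega) p d) hf.isBlock
      (HeckeAlgebra.signChar_of_isEmptyCoreBlockIdempotent (by omega) hf)
    exact ⟨HeckeAlgebra.isIsoToDirectSummand_block (HeckeAlgebra.genSeq_mem_of_sizeUpTo _)
        hf.isBlock hw hwf,
      HeckeAlgebra.isRelativelyProjectiveBimodule_block (HeckeAlgebra.genSeq_mem_of_sizeUpTo _)
        hf.isBlock hw hwf⟩
  · subst hp
    have : CharZero F := CharP.charP_to_charZero F
    rcases hroot with h | ⟨-, h2, rfl⟩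
    · exact HeckeAlgebra.isRelativelyProjectiveBimodule_rect he h d
    · exact absurd he (by omega)
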